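/- Let $d\ge 3$ and let $\Omega\subset\mathbb{RP}^d$ be an irreducible divisible properly convex domain. Here: $\Omega$ is properly convex if it is open, its closure is contained in an affine chart, and it is convex in that chart; it is divisible if some discrete subgroup $\Gamma<\mathrm{PGL}(d+1,\mathbb{R})$ preserves $\Omega$ with compact quotient $\Gamma\backslash\Omega$; it is reducible if the cone $C(\Omega)$ (a connected component of the preimage of $\Omega$ in $\mathbb{R}^{d+1}\setminus\{0\}$) is a direct sum $C_1\oplus C_2$ of convex cones $C_i\subset V_i$ with $\mathbb{R}^{d+1}=V_1\oplus V_2$ and $V_1,V_2$ proper subspaces, and irreducible otherwise. Let $d_\Omega(x,y)=\tfrac12\log[z_1,x,y,z_2]$ be the Hilbert metric of $\Omega$, where $z_1,z_2\in\partial\Omega$ are the boundary points on the line through $x$ and $y$, in the order $z_1,x,y,z_2$, and put $d_\Omega(x,S)=\inf_{y\in S}d_\Omega(x,y)$. Let $\mathscr F$ be the set of codimension-one flats of $\Omega$, that is, of the open $(d-1)$-dimensional simplices $F\subset\Omega$ whose relative boundary $\partial F$ is contained in $\partial\Omega$. A hyperplane supports a subset of $\partial\Omega$ if it contains this subset and does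 not meet $\Omega$. Then for every $F\in\mathscr F$ there is exactly one point $\hat F\in\mathbb{RP}^d$, the pseudo-dual of $F$, that lies on all the hyperplanes supporting $\Omega$ along the $(d-2)$-dimensional faces of $F$. For $x\in F$ let the normal line $n_F(x)$ be the projective line spanned by $x$ and $\hat F$. There is a number $\varepsilon_\Omega>0$ such that for all $F,F'\in\mathscr F$ and all $x\in F$ with $d_\Omega(x,F')<\varepsilon_\Omega$, $$n_F(x)\cap F'\neq\emptyset .$$ -/

import Mathlib

open scoped LinearAlgebra.Projectivization MatrixGroups Pointwise

noncomputable section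

namespace HilbertGeometry

/-- Real projective space of dimension `d`. -/
abbrev RP (d : ℕ) : Type := ℙ ℝ (Fin (d + 1) → ℝ)

/-- The quotient topology on real projective space. -/
instance instTopologicalSpaceRP (d : ℕ) : TopologicalSpace (RP d) :=
  inferInstanceAs (TopologicalSpace (Quotient (projectivizationSetoid ℝ (Fin (d + 1) → ℝ))))

/-- The projective general linear group `PGL(d+1, ℝ)`, acting on `RP d`. -/
abbrev ProjGL (d : ℕ) : Type := Matrix.ProjGenLinGroup (Fin (d + 1)) ℝ

/-- The quotient topology on the projective general linear group. -/
instance instTopologicalSpaceProjGL (d : ℕ) : TopologicalSpace (ProjGL d) :=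
  inferInstanceAs
    (TopologicalSpace (GL (Fin (d + 1)) ℝ ⧸ Subgroup.center (GL (Fin (d + 1)) ℝ)))

variable {d : ℕ}

/-- `v` is a (nonzero) vector on the line `p`, that is, `p = [v]`. -/
def Represents (v : Fin (d + 1) → ℝ) (p : RP d) : Prop :=
  ∃ h : v ≠ 0, Projectivization.mk ℝ v h = p

/-- The preimage in `ℝ^(d+1) ∖ {0}` of a set of points of projective space. -/
def preimage (Ω : Set (RP d)) : Set (Fin (d + 1) → ℝ) :=
  {v | ∃ p ∈ Ω, Represents v p}

/-- A properly convex projective domain: an open set whose closure lies in some affine chart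
`{η ≠ 0}`, and which is convex as a subset of the affine space `{η = 1}`. -/
def IsProperlyConvex (Ω : Set (RP d)) : Prop :=
  IsOpen Ω ∧ ∃ η : Module.Dual ℝ (Fin (d + 1) → ℝ), η ≠ 0 ∧
    (∀ v ∈ preimage (closure Ω), η v ≠ 0) ∧
    Convex ℝ {v | η v = 1 ∧ v ∈ preimage Ω}

/-- The group of projective transformations preserving `Ω`. -/
def Aut (Ω : Set (RP d)) : Subgroup (ProjGL d) :=
  MulAction.stabilizer (ProjGL d) Ω

/-- The relation on `Ω` of lying in the same `Γ`-orbit. -/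
def orbitSetoid (Γ : Subgroup (ProjGL d)) (Ω : Set (RP d)) : Setoid Ω where
  r x y := ∃ g ∈ Γ, g • (x : RP d) = y
  iseqv :=
    { refl := fun x => ⟨1, Γ.one_mem, one_smul _ _⟩
      symm := by
        rintro x y ⟨g, hg, h⟩
        exact ⟨g⁻¹, Γ.inv_mem hg, by rw [← h, inv_smul_smul]⟩
      trans := by
        rintro x y z ⟨g, hg, h⟩ ⟨k, hk, h'⟩
        exact ⟨k * g, Γ.mul_mem hk hg, by rw [mul_smul, h, h']⟩ }

/-- `Γ` divides `Ω`: it is a discrete subgroup of `Aut Ω` with compact quotient `Γ \ Ω`. -/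
def Divides (Γ : Subgroup (ProjGL d)) (Ω : Set (RP d)) : Prop :=
  Γ ≤ Aut Ω ∧ DiscreteTopology Γ ∧ CompactSpace (Quotient (orbitSetoid Γ Ω))

/-- `Ω` is divisible. -/
def IsDivisible (Ω : Set (RP d)) : Prop :=
  ∃ Γ : Subgroup (ProjGL d), Divides Γ Ω

/-- `Ω` is reducible: a component of its preimage (a cone over `Ω`) is the direct sum of two convex
cones lying in complementary proper vector subspaces. -/
def IsReducible (Ω : Set (RP d)) : Prop :=
  ∃ v₀ ∈ preimage Ω, ∃ V₁ V₂ : Submodule ℝ (Fin (d + 1) → ℝ), V₁ ≠ ⊤ ∧ V₂ ≠ ⊤ ∧ IsCompl V₁ V₂ ∧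
    ∃ C₁ C₂ : ConvexCone ℝ (Fin (d + 1) → ℝ),
      (C₁ : Set (Fin (d + 1) → ℝ)) ⊆ V₁ ∧ (C₂ : Set (Fin (d + 1) → ℝ)) ⊆ V₂ ∧
      connectedComponentIn (preimage Ω) v₀ =
        (C₁ : Set (Fin (d + 1) → ℝ)) + (C₂ : Set (Fin (d + 1) → ℝ))

/-- The collinear points `a, x, y, b` have cross ratio `[a, x, y, b] = c`. In the affine coordinate
on the line with `a = [u]` at `0` and `b = [w]` at `∞`, in which `x` and `y` have coordinates
`s` and `t`, this cross ratio is `t / s`; in any affine chart it is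
`(|y - a| |b - x|) / (|x - a| |b - y|)` up to sign. -/
def HasCrossRatio (a x y b : RP d) (c : ℝ) : Prop :=
  ∃ (u w : Fin (d + 1) → ℝ) (s t : ℝ), LinearIndependent ℝ ![u, w] ∧ s ≠ 0 ∧
    Represents u a ∧ Represents w b ∧ Represents (u + s • w) x ∧ Represents (u + t • w) y ∧
    c = t / s

/-- The Hilbert distance `½ log [z₁, x, y, z₂]` of two points of a properly convex domain `Ω`, where
`z₁, z₂` are the boundary points of `Ω` on the line through `x` and `y`, in the order
`z₁, x, y, z₂`. The order is the one for which the cross ratio is at least `1`. For `x, y ∈ Ω` the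
set below has exactly one element (if `x = y`, any line through `x` gives the value `0`). -/
def hilbertDist (Ω : Set (RP d)) (x y : RP d) : ℝ :=
  sInf {r | ∃ z₁ ∈ frontier Ω, ∃ z₂ ∈ frontier Ω, ∃ c : ℝ, 1 ≤ c ∧
    HasCrossRatio z₁ x y z₂ c ∧ r = 1 / 2 * Real.log c}

/-- The Hilbert distance from a point to a (nonempty) set. -/
def hilbertInfDist (Ω : Set (RP d)) (x : RP d) (S : Set (RP d)) : ℝ :=
  sInf (hilbertDist Ω x '' S)

/-- The open simplex with vertices `[e i]`, with respect to the chosen representatives `e i`. -/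
def openSimplex {k : ℕ} (e : Fin k → Fin (d + 1) → ℝ) : Set (RP d) :=
  {p | ∃ a : Fin k → ℝ, (∀ i, 0 < a i) ∧ Represents (∑ i, a i • e i) p}

/-- The boundary of a set that is open in the projective subspace which it spans. -/
def relBoundary (S : Set (RP d)) : Set (RP d) := closure S \ S

/-- The codimension-one flats of `Ω`: the open `(d-1)`-dimensional simplices `F ⊆ Ω` that are
properly embedded, that is, `∂F ⊆ ∂Ω`. -/
def flats (Ω : Set (RP d)) : Set (Set (RP d)) :=
  {F | (∃ e : Fin d → Fin (d + 1) → ℝ, LinearIndependent ℝ e ∧ F = openSimplex e) ∧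
    F ⊆ Ω ∧ relBoundary F ⊆ frontier Ω}

/-- `H` is a projective hyperplane. -/
def IsHyperplane (H : Projectivization.Subspace ℝ (Fin (d + 1) → ℝ)) : Prop :=
  Module.finrank ℝ (Projectivization.Subspace.submodule H) = d

/-- `K` is a `k`-dimensional face of the simplex `F` (more generally, of a convex set that is open
in the projective subspace which it spans): the intersection of `∂F` with a hyperplane that does not
meet `F`, such that the projective subspace spanned by `K` has dimension `k`. -/
def IsFace (F : Set (RP d)) (k : ℕ) (K : Set (RP d)) : Prop :=
  (∃ P : Projectivization.Subspace ℝ (Fin (d + 1) → ℝ), IsHyperplane P ∧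
    Disjoint (P : Set (RP d)) F ∧ K = relBoundary F ∩ P) ∧
  Module.finrank ℝ (Projectivization.Subspace.submodule (Projectivization.Subspace.span K)) = k + 1

/-- The hyperplane `H` supports `K ⊆ ∂Ω`: it contains `K` and does not meet `Ω`. -/
def Supports (Ω : Set (RP d)) (H : Projectivization.Subspace ℝ (Fin (d + 1) → ℝ))
    (K : Set (RP d)) : Prop :=
  IsHyperplane H ∧ K ⊆ H ∧ Disjoint (H : Set (RP d)) Ω

/-- `p` is the pseudo-dual of the flat `F`: the unique point that lies on every hyperplane
supporting `Ω` along a `(d-2)`-dimensional face of `F`. -/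
def IsPseudoDual (Ω F : Set (RP d)) (p : RP d) : Prop :=
  ∀ q : RP d, (∀ K, IsFace F (d - 2) K → ∀ H, Supports Ω H K → q ∈ H) ↔ q = p

/-- The projective line through `x` and `p`; when `p` is the pseudo-dual of a flat `F` and `x ∈ F`,
this is the normal line to `F` at `x`. -/
def projLine (x p : RP d) : Set (RP d) :=
  (Projectivization.Subspace.span {x, p} : Projectivization.Subspace ℝ (Fin (d + 1) → ℝ))

end HilbertGeometry

end

open HilbertGeometry

/-! Everything is lifted to the cone `C` over Ω: a sharp open convex cone, with linear automorphisms
(scalars included) acting cocompactly, which does not split because Ω is irreducible. Hilbert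
distance becomes the cone order: points at distance less than ½ log(1 + ε) have lifts with x ≤ y ≤
(1 + ε)x.

The engine is a blow-up, `IsSharpCone.splits_of_face`. Let V be a proper nonzero subspace that is
the common kernel of two supporting functionals (possibly equal), and let the closure of `C` have
interior relative to V. Contract a complement of V so that a point of `C` moves to a relatively
interior point of this face, and bring it back to a compact set by automorphisms. The composed maps
and their inverses stay bounded, so a subsequence converges to an isomorphism carrying the tangent
cone along V, which is a product, onto `C` up to closure. Hence `C` splits.

There are two consequences. A facet of a flat spans a subspace of codimension two, and two different
supporting hyperplanes along it would cut out exactly that span, so the supporting hyperplane is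
unique (`IsConeFlat.support_unique`). The d functionals of a flat then have a common zero in
dimension d + 1, unique up to scaling because it is transverse to the flat: the pseudo-dual.
Secondly, two flats with a common point span the same hyperplane (`IsConeFlat.span_eq_of_sum_eq`):
otherwise a facet of one and a facet of the other lie in one supporting hyperplane and together span
it, which again splits `C`.

The number ε comes from compactness (`exists_eps_of_isCompact`). A sequence of counterexamples with
ε → 0, moved by automorphisms so that the marked points stay in a compact set, converges to two
flats with a common point, hence with the same span. The limiting normal direction is transverse to
that span, so the normal lines meet the second flat already before the limit. -/

namespace HilbertGeometry

open Filter Topology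

/-! ### Sharp convex cones and their supporting functionals -/

section Cones

variable {E : Type*} [NormedAddCommGroup E] [NormedSpace ℝ E]

/-- An open convex cone, without the origin, whose closure contains no line. -/
structure IsSharpCone (C : Set E) : Prop where
  isOpen : IsOpen C
  nonempty : C.Nonempty
  zero_notMem : (0 : E) ∉ C
  add_mem : ∀ {x y : E}, x ∈ C → y ∈ C → x + y ∈ C
  smul_mem : ∀ {c : ℝ} {x : E}, 0 < c → x ∈ C → c • x ∈ C
  exists_pos : ∃ η : E →L[ℝ] ℝ, ∀ x ∈ closure C, x ≠ 0 → 0 < η x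

/-- The linear automorphisms of `C` act cocompactly on `C` up to scaling. -/
def IsCocompactCone (C : Set E) : Prop :=
  ∃ K ⊆ C, IsCompact K ∧ ∀ x ∈ C, ∃ g : E ≃L[ℝ] E, (∀ y, g y ∈ C ↔ y ∈ C) ∧ g x ∈ K

/-- `C` is the sum of its images under two complementary nontrivial projections. -/
def Splits (C : Set E) : Prop :=
  ∃ P : E →ₗ[ℝ] E, (∀ x, P (P x) = P x) ∧ P ≠ 0 ∧ P ≠ LinearMap.id ∧
    ∀ x ∈ C, ∀ y ∈ C, P x + (y - P y) ∈ C

/-- By homogeneity it suffices that `η` has a positive minimum on the compact slice of `S` by the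
unit sphere. -/
lemma exists_norm_le_mul [FiniteDimensional ℝ E] {S : Set E} (hS : IsClosed S)
    (hsmul : ∀ c : ℝ, 0 < c → ∀ x ∈ S, c • x ∈ S) {η : E →L[ℝ] ℝ}
    (hη : ∀ x ∈ S, x ≠ 0 → 0 < η x) : ∃ κ : ℝ, 0 < κ ∧ ∀ x ∈ S, ‖x‖ ≤ κ * η x := by
  have hunit : ∀ x ∈ S, x ≠ 0 → ‖x‖⁻¹ • x ∈ S ∩ Metric.sphere 0 1 := by
    intro x hx hx0
    have : 0 < ‖x‖ := norm_pos_iff.2 hx0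
    refine ⟨hsmul _ (by positivity) x hx, ?_⟩
    simp [norm_smul, this.ne']
  have hcomp : IsCompact (S ∩ Metric.sphere 0 1) := (isCompact_sphere (0 : E) 1).inter_left hS
  rcases (S ∩ Metric.sphere 0 1).eq_empty_or_nonempty with h | h
  · refine ⟨1, one_pos, fun x hx => ?_⟩
    by_cases hx0 : x = 0
    · simp [hx0]
    · have := hunit x hx hx0
      simp [h] at this
  · obtain ⟨m, hm, hmin⟩ := hcomp.exists_isMinOn h η.continuous.continuousOn
    have hm0 : 0 < η m := hη m hm.1 (by
      rintro rfl
      simpa using hm.2)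
    refine ⟨(η m)⁻¹, inv_pos.2 hm0, fun x hx => ?_⟩
    by_cases hx0 : x = 0
    · simp [hx0]
    · have h1 : η m ≤ η (‖x‖⁻¹ • x) := hmin (hunit x hx hx0)
      have : 0 < ‖x‖ := norm_pos_iff.2 hx0
      rw [map_smul, smul_eq_mul] at h1
      rw [inv_mul_eq_div, le_div_iff₀ hm0]
      calc ‖x‖ * η m ≤ ‖x‖ * (‖x‖⁻¹ * η x) := by gcongr
        _ = η x := by field_simp

/-- A linear map which sends a ball around `x` into a set on which the functional `φ` dominates the
norm is bounded in terms of `φ (L x)`. -/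
lemma opNorm_le_of_le_functional {L : E →L[ℝ] E} {φ : E →L[ℝ] ℝ} {x : E} {r R : ℝ} (hr : 0 < r)
    (hφ : ∀ w, ‖w‖ ≤ r → ‖L (x + w)‖ ≤ φ (L (x + w))) (hR : φ (L x) ≤ R) :
    ‖L‖ ≤ 3 * R / r := by
  have hx : ‖L x‖ ≤ φ (L x) := by simpa using hφ 0 (by simpa using hr.le)
  have hR0 : 0 ≤ R := (norm_nonneg _).trans (hx.trans hR)
  -- The values of φ ∘ L at x + w and x - w are nonnegative with sum 2 φ(L x) ≤ 2R. So ‖L(x + w)‖ ≤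
  -- 2R, and subtracting L x costs another R.
  have key : ∀ w, ‖w‖ ≤ r → ‖L w‖ ≤ 3 * R := by
    intro w hw
    have h1 := hφ w hw
    have h2 := hφ (-w) (by simpa using hw)
    have h3 := (norm_nonneg _).trans h2
    have h4 : ‖L w‖ ≤ ‖L (x + w)‖ + ‖L x‖ := by
      have : L w = L (x + w) - L x := by simp
      rw [this]
      exact norm_sub_le _ _
    simp only [map_add, map_neg] at *
    linarith
  refine ContinuousLinearMap.opNorm_le_bound _ (by positivity) fun w => ?_
  by_cases hw : w = 0
  · simp [hw]
  have hw' : 0 < ‖w‖ := norm_pos_iff.2 hw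
  have := key ((r / ‖w‖) • w) (by
    rw [norm_smul, Real.norm_of_nonneg (by positivity)]
    field_simp
    rfl)
  rw [map_smul, norm_smul, Real.norm_of_nonneg (by positivity)] at this
  rw [div_mul_eq_mul_div, le_div_iff₀ hr]
  rw [div_mul_eq_mul_div, div_le_iff₀ hw'] at this
  linarith

namespace IsSharpCone

variable {C : Set E} (hC : IsSharpCone C)
include hC

lemma closure_add {x y : E} (hx : x ∈ closure C) (hy : y ∈ closure C) : x + y ∈ closure C :=
  map_mem_closure₂ continuous_add hx hy fun _ ha _ hb => hC.add_mem ha hb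

lemma closure_smul_pos {c : ℝ} (hc : 0 < c) {x : E} (hx : x ∈ closure C) : c • x ∈ closure C :=
  map_mem_closure (continuous_const_smul c) hx fun _ ha => hC.smul_mem hc ha

lemma zero_mem_closure : (0 : E) ∈ closure C := by
  obtain ⟨x, hx⟩ := hC.nonempty
  have : Tendsto (fun n : ℕ => (1 / ((n : ℝ) + 1)) • x) atTop (𝓝 ((0 : ℝ) • x)) :=
    tendsto_one_div_add_atTop_nhds_zero_nat.smul_const x
  rw [zero_smul] at this
  exact mem_closure_of_tendsto this (Eventually.of_forall fun n => hC.smul_mem (by positivity) hx)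

lemma closure_smul {c : ℝ} (hc : 0 ≤ c) {x : E} (hx : x ∈ closure C) : c • x ∈ closure C := by
  rcases hc.eq_or_lt with rfl | h
  · simpa using hC.zero_mem_closure
  · exact hC.closure_smul_pos h hx

lemma exists_sub_smul_mem {x : E} (hx : x ∈ C) (y : E) :
    ∃ ε : ℝ, 0 < ε ∧ ∀ t : ℝ, |t| ≤ ε → x - t • y ∈ C := by
  have h : Tendsto (fun t : ℝ => x - t • y) (𝓝 0) (𝓝 x) := by
    have : Continuous fun t : ℝ => x - t • y := by fun_prop
    simpa using this.tendsto 0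
  obtain ⟨ε, hε, h⟩ := Metric.eventually_nhds_iff.1 (h.eventually (hC.isOpen.mem_nhds hx))
  refine ⟨ε / 2, by positivity, fun t ht => h ?_⟩
  simp only [Real.dist_eq, sub_zero]
  linarith

/-- For z in `C` close enough to x, the difference x + y - z is still in `C` by openness. -/
lemma closure_add_mem {x y : E} (hx : x ∈ closure C) (hy : y ∈ C) : x + y ∈ C := by
  have : (fun z => x + y - z) ⁻¹' C ∈ 𝓝 x := by
    have hc : Continuous fun z => x + y - z := by fun_prop
    exact hc.continuousAt.preimage_mem_nhds (hC.isOpen.mem_nhds (by simpa using hy))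
  obtain ⟨z, hz, hzC⟩ := mem_closure_iff_nhds.1 hx _ this
  simpa using hC.add_mem hz hzC

lemma convex : Convex ℝ C := by
  intro x hx y hy a b ha hb hab
  rcases ha.eq_or_lt with rfl | ha'
  · rcases hb.eq_or_lt with rfl | hb'
    · norm_num at hab
    · simpa using hC.smul_mem hb' hy
  · exact add_comm (b • y) (a • x) ▸ hC.closure_add_mem
      (hC.closure_smul hb (subset_closure hy)) (hC.smul_mem ha' hx)

omit hC in
lemma nonneg_of_mem_closure {h : E →L[ℝ] ℝ} (hh : ∀ x ∈ C, 0 ≤ h x) {x : E} (hx : x ∈ closure C) :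
    0 ≤ h x :=
  closure_minimal (t := {x | 0 ≤ h x}) hh (isClosed_le continuous_const h.continuous) hx

/-- A zero at a point of the open set `C` would be an interior minimum of a linear functional. -/
lemma pos_of_nonneg {h : E →L[ℝ] ℝ} (hh : ∀ x ∈ C, 0 ≤ h x) (h0 : h ≠ 0) {x : E} (hx : x ∈ C) :
    0 < h x := by
  refine (hh x hx).lt_of_ne fun hx0 => h0 ?_
  ext y
  obtain ⟨ε, hε, hy⟩ := hC.exists_sub_smul_mem hx y
  have h1 := hh _ (hy ε (by rw [abs_of_pos hε]))
  have h2 := hh _ (hy (-ε) (by rw [abs_neg, abs_of_pos hε]))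
  simp only [map_sub, map_smul, smul_eq_mul, ← hx0] at h1 h2
  have h3 : ε * h y = 0 := by linarith
  simpa [hε.ne'] using h3

lemma ne_zero {x : E} (hx : x ∈ C) : x ≠ 0 := fun h => hC.zero_notMem (h ▸ hx)

lemma neg_notMem_closure {x : E} (hx : x ∈ closure C) (hx0 : x ≠ 0) : -x ∉ closure C := by
  obtain ⟨η, hη⟩ := hC.exists_pos
  intro h
  have h1 := hη x hx hx0
  have h2 := hη _ h (neg_ne_zero.2 hx0)
  rw [map_neg] at h2
  linarith

lemma exists_norm_le [FiniteDimensional ℝ E] :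
    ∃ η : E →L[ℝ] ℝ, ∀ x ∈ closure C, ‖x‖ ≤ η x := by
  obtain ⟨η, hη⟩ := hC.exists_pos
  obtain ⟨κ, hκ, h⟩ := exists_norm_le_mul isClosed_closure
    (fun c hc x hx => hC.closure_smul_pos hc hx) hη
  exact ⟨κ • η, by simpa using h⟩

/-- A point of the closure outside the cone lies in the kernel of a supporting functional. -/
lemma exists_support {p : E} (hp : p ∉ C) (hpc : p ∈ closure C) :
    ∃ h : E →L[ℝ] ℝ, (∀ x ∈ C, 0 < h x) ∧ h p = 0 := by
  obtain ⟨f, hf⟩ := geometric_hahn_banach_point_open hC.convex hC.isOpen hp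
  obtain ⟨z, hz⟩ := hC.nonempty
  have hle : f p ≤ 0 := by
    have h0 : f p ≤ f 0 := closure_minimal (t := {x | f p ≤ f x}) (fun x hx => (hf x hx).le)
      (isClosed_le continuous_const f.continuous) hC.zero_mem_closure
    simpa using h0
  have hnn : ∀ x ∈ C, 0 ≤ f x := by
    intro x hx
    by_contra hneg
    push Not at hneg
    -- The scalar is chosen so that `f` takes the value f p - 1 at the multiple of x, below its
    -- lower bound f p.
    have h1 := hf _ (hC.smul_mem (c := (f p - 1) / f x)
      (div_pos_of_neg_of_neg (by linarith) hneg) hx)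
    rw [map_smul, smul_eq_mul, div_mul_cancel₀ _ hneg.ne] at h1
    linarith
  have hp0 : f p = 0 := le_antisymm hle (nonneg_of_mem_closure hnn hpc)
  exact ⟨f, fun x hx => by simpa [hp0] using hf x hx, hp0⟩

end IsSharpCone

end Cones

/-! ### Blowing up a cocompact cone along a face -/

section Cones

variable {E : Type*} [NormedAddCommGroup E] [NormedSpace ℝ E]

lemma IsSharpCone.add_smul_mem_of_le {C : Set E} (hC : IsSharpCone C) {v u : E} {s t : ℝ}
    (hv : v ∈ closure C) (hs : v + s • u ∈ C) (ht : 0 < t) (hts : t ≤ s) : v + t • u ∈ C := by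
  have hs0 : 0 < s := ht.trans_le hts
  have h1 : v + t • u = (1 - t / s) • v + (t / s) • (v + s • u) := by
    rw [smul_add, smul_smul, div_mul_cancel₀ _ hs0.ne', ← add_assoc, ← add_smul]
    simp
  rw [h1]
  exact hC.closure_add_mem (hC.closure_smul (by rw [sub_nonneg, div_le_one hs0]; exact hts) hv)
    (hC.smul_mem (by positivity) hs)

/-- If `p` is a projection and `D` is a linear isomorphism such that `D z` lies in `C` (up to
closure) according as `p z + t (z - p z)` lies in `C` for small `t > 0`, then `C` splits. -/
lemma IsSharpCone.splits_of_limit {C : Set E} (hC : IsSharpCone C) {p : E →L[ℝ] E}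
    (hp : ∀ x, p (p x) = p x) (hp0 : ∃ x, p x ≠ 0) (hp1 : ∃ x, p x ≠ x) {D B : E →L[ℝ] E}
    (hDB : ∀ x, D (B x) = x) (hBD : ∀ x, B (D x) = x)
    (h1 : ∀ z, D z ∈ C → p z ∈ closure C ∧ ∃ t : ℝ, 0 < t ∧ p z + t • (z - p z) ∈ C)
    (h2 : ∀ z, (∃ t : ℝ, 0 < t ∧ ∀ s : ℝ, 0 < s → s ≤ t → p z + s • (z - p z) ∈ C) →
      D z ∈ closure C) : Splits C := by
  -- The product structure of the tangent cone. Since z - εz' is still in the preimage of `C`, p(z -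
  -- εz') lies in the closure; adding ε times a point pz' + t(z' - pz') of `C` gives pz + εt(z' -
  -- pz') in `C`.
  have hcl : ∀ z z', D z ∈ C → D z' ∈ C → D (p z + (z' - p z')) ∈ closure C := by
    intro z z' hz hz'
    obtain ⟨ε, hε, hsub⟩ := hC.exists_sub_smul_mem hz (D z')
    have hz2 : D (z - ε • z') ∈ C := by
      simpa using hsub ε (by rw [abs_of_pos hε])
    obtain ⟨t, ht, hmem⟩ := (h1 _ hz').2
    have hpz : p (p z + (z' - p z')) = p z := by simp [hp]
    refine h2 _ ⟨ε * t, by positivity, fun s hs hst => ?_⟩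
    rw [hpz, add_sub_cancel_left]
    refine hC.add_smul_mem_of_le (h1 _ hz).1 ?_ hs hst
    have := hC.closure_add_mem (h1 _ hz2).1 (hC.smul_mem hε hmem)
    convert this using 1
    simp only [map_sub, map_smul]
    module
  -- The splitting projection of `C` is `p` transported by `D`.
  refine ⟨(D.comp (p.comp B)).toLinearMap, fun x => ?_, fun h => ?_, fun h => ?_,
    fun x hx y hy => ?_⟩
  · simp [hBD, hp]
  · obtain ⟨x, hx⟩ := hp0
    have := LinearMap.congr_fun h (D x)
    simp only [ContinuousLinearMap.coe_coe, ContinuousLinearMap.comp_apply, hBD,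
      LinearMap.zero_apply] at this
    exact hx (by rw [← hBD (p x), this, map_zero])
  · obtain ⟨x, hx⟩ := hp1
    have := LinearMap.congr_fun h (D x)
    simp only [ContinuousLinearMap.coe_coe, ContinuousLinearMap.comp_apply, hBD,
      LinearMap.id_apply] at this
    exact hx (by rw [← hBD (p x), this, hBD])
  · obtain ⟨c, hc⟩ := hC.nonempty
    obtain ⟨ε, hε, hx'⟩ := hC.exists_sub_smul_mem hx c
    obtain ⟨ε', hε', hy'⟩ := hC.exists_sub_smul_mem hy c
    -- To pass from the closure to `C`, both points are shifted by -δc and δc is added at the end;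
    -- the contributions of c cancel.
    set δ := min ε ε'
    have hδ : 0 < δ := lt_min hε hε'
    have hx2 := hx' δ (by rw [abs_of_pos hδ]; exact min_le_left _ _)
    have hy2 := hy' δ (by rw [abs_of_pos hδ]; exact min_le_right _ _)
    have := hC.closure_add_mem (hcl (B (x - δ • c)) (B (y - δ • c)) (by rwa [hDB]) (by rwa [hDB]))
      (hC.smul_mem hδ hc)
    convert this using 1
    simp only [ContinuousLinearMap.coe_coe, ContinuousLinearMap.comp_apply, map_sub, map_add,
      map_smul, hDB]
    module

variable [FiniteDimensional ℝ E]

/-- Blowing up a cocompact cone along a subspace `V` cut out by two supporting functionals, and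
containing a point interior relative to `V` of the boundary, shows that the cone splits. -/
theorem IsSharpCone.splits_of_face {C : Set E} (hC : IsSharpCone C) (hK : IsCocompactCone C)
    {V : Submodule ℝ E} (hbot : V ≠ ⊥) (htop : V ≠ ⊤) {v₀ : E} (hv₀ : v₀ ∈ V) {δ : ℝ} (hδ : 0 < δ)
    (hball : ∀ v ∈ V, ‖v - v₀‖ < δ → v ∈ closure C) {f g : E →L[ℝ] ℝ} (hf : ∀ x ∈ C, 0 ≤ f x)
    (hg : ∀ x ∈ C, 0 ≤ g x) (hV : ∀ x, x ∈ V ↔ f x = 0 ∧ g x = 0) : Splits C := by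
  obtain ⟨K, hKC, hKc, hK⟩ := hK
  obtain ⟨η, hη⟩ := hC.exists_norm_le
  -- the projection onto `V`
  obtain ⟨p, hpV, hpid⟩ : ∃ p : E →L[ℝ] E, (∀ x, p x ∈ V) ∧ ∀ x ∈ V, p x = x := by
    obtain ⟨q, hq⟩ := V.subtype.exists_leftInverse_of_injective V.ker_subtype
    refine ⟨LinearMap.toContinuousLinearMap (V.subtype ∘ₗ q), fun x => by simp, fun x hx => ?_⟩
    have := LinearMap.congr_fun hq ⟨x, hx⟩
    simp only [LinearMap.comp_apply, Submodule.subtype_apply, LinearMap.id_apply] at this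
    simp [this]
  have hpp : ∀ x, p (p x) = p x := fun x => hpid _ (hpV x)
  have hfp : ∀ x, f (p x) = 0 := fun x => ((hV _).1 (hpV x)).1
  have hgp : ∀ x, g (p x) = 0 := fun x => ((hV _).1 (hpV x)).2
  have hv₀c : v₀ ∈ closure C := hball v₀ hv₀ (by simpa using hδ)
  -- the dilations in the complementary direction
  let a : ℝ → E →L[ℝ] E := fun t => p + t • (ContinuousLinearMap.id ℝ E - p)
  have ha : ∀ t x, a t x = p x + t • (x - p x) := fun t x => by simp [a]
  have haa : ∀ s t x, a s (a t x) = a (s * t) x := by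
    intro s t x
    simp only [ha, map_add, map_smul, map_sub, hpp]
    module
  have ha1 : ∀ x, a 1 x = x := fun x => by simp [ha]
  have hpa : ∀ t x, p (a t x) = p x := fun t x => by simp [ha, hpp]
  have hanti : ∀ z t s, p z ∈ closure C → a s z ∈ C → 0 < t → t ≤ s → a t z ∈ C := by
    intro z t s hz hs ht hts
    rw [ha] at hs ⊢
    exact hC.add_smul_mem_of_le hz hs ht hts
  -- a point near the face
  obtain ⟨w₀, hw₀C, hw₀⟩ : ∃ w₀ ∈ C, p w₀ = v₀ := by
    obtain ⟨c, hc⟩ := hC.nonempty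
    set ε : ℝ := δ / (2 * (‖p c‖ + 1))
    have hε : 0 < ε := by positivity
    have hmem : v₀ - ε • p c ∈ closure C := by
      refine hball _ (V.sub_mem hv₀ (V.smul_mem _ (hpV c))) ?_
      rw [sub_sub_cancel_left, norm_neg, norm_smul, Real.norm_of_nonneg hε.le]
      simp only [ε]
      rw [div_mul_eq_mul_div, div_lt_iff₀ (by positivity)]
      nlinarith [norm_nonneg (p c)]
    refine ⟨_, hC.closure_add_mem hmem (hC.smul_mem hε hc), ?_⟩
    simp [hpp, hpid v₀ hv₀]
  -- A whole ball around `w₀` stays in `C` under all contractions `a t` with 0 < t ≤ 1, since its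
  -- projection lies in the face. This makes the bound on `D n` uniform.
  obtain ⟨r, hr, hrball⟩ : ∃ r : ℝ, 0 < r ∧ ∀ w, ‖w‖ ≤ r → p (w₀ + w) ∈ closure C ∧ w₀ + w ∈ C := by
    have h1 : ∀ᶠ w in 𝓝 (0 : E), w₀ + w ∈ C := by
      have : Continuous fun w : E => w₀ + w := by fun_prop
      exact this.continuousAt.eventually_mem (hC.isOpen.mem_nhds (by simpa using hw₀C))
    have h2 : ∀ᶠ w in 𝓝 (0 : E), ‖p w‖ < δ := by
      have : Continuous fun w : E => ‖p w‖ := by fun_prop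
      exact this.tendsto' 0 0 (by simp) |>.eventually_lt_const hδ
    obtain ⟨r, hr, h⟩ := Metric.eventually_nhds_iff.1 (h1.and h2)
    refine ⟨r / 2, by positivity, fun w hw => ?_⟩
    have := h (y := w) (by rw [dist_zero_right]; linarith)
    refine ⟨hball _ (hpV _) ?_, this.1⟩
    rw [map_add, hw₀, add_sub_cancel_left]
    exact this.2
  -- domination of the norm off `V`
  obtain ⟨κ, hκ, hfg⟩ : ∃ κ : ℝ, 0 < κ ∧ ∀ x, p x = 0 → 0 ≤ f x → 0 ≤ g x →
      ‖x‖ ≤ κ * (f + g) x := by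
    have hcl : IsClosed {x | p x = 0 ∧ 0 ≤ f x ∧ 0 ≤ g x} :=
      (isClosed_eq p.continuous continuous_const).inter
        ((isClosed_le continuous_const f.continuous).inter
          (isClosed_le continuous_const g.continuous))
    obtain ⟨κ, hκ, h⟩ := exists_norm_le_mul (η := f + g) hcl (fun c hc x hx => by
      refine ⟨by simp [hx.1], ?_, ?_⟩
      · rw [map_smul]; exact mul_nonneg hc.le hx.2.1
      · rw [map_smul]; exact mul_nonneg hc.le hx.2.2) (fun x hx hx0 => by
      obtain ⟨h1, h2, h3⟩ := hx
      rw [add_apply]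
      -- Both values are nonnegative with sum at most 0, so both vanish. Here it matters that V is
      -- the whole common kernel of `f` and `g`.
      by_contra hle
      have hxV : x ∈ V := (hV x).2 ⟨by linarith, by linarith⟩
      exact hx0 (by rw [← hpid x hxV, h1]))
    exact ⟨κ, hκ, fun x h1 h2 h3 => h x ⟨h1, h2, h3⟩⟩
  -- the rescaled automorphisms
  let m : ℕ → ℝ := fun n => (n : ℝ) + 1
  have hm : ∀ n, 0 < m n := fun n => by positivity
  have hm1 : ∀ n, (m n)⁻¹ ≤ 1 := fun n => inv_le_one_of_one_le₀ (by simp [m])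
  have hmi : ∀ n, 0 < (m n)⁻¹ := fun n => inv_pos.2 (hm n)
  have hx : ∀ n, a (m n)⁻¹ w₀ ∈ C := fun n =>
    hanti w₀ _ 1 (by rw [hw₀]; exact hv₀c) (by rwa [ha1]) (hmi n) (hm1 n)
  -- The points `a (m n)⁻¹ w₀` tend to the boundary point `v₀`; the automorphisms `γ n` return them
  -- to `K`.
  choose γ hγC hγK using fun n => hK _ (hx n)
  let D : ℕ → E →L[ℝ] E := fun n => (γ n : E →L[ℝ] E).comp (a (m n)⁻¹)
  let B : ℕ → E →L[ℝ] E := fun n => (a (m n)).comp ((γ n).symm : E →L[ℝ] E)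
  have hD : ∀ n z, D n z = γ n (a (m n)⁻¹ z) := fun n z => rfl
  have hB : ∀ n z, B n z = a (m n) ((γ n).symm z) := fun n z => rfl
  have hDB : ∀ n x, D n (B n x) = x := fun n x => by
    rw [hD, hB, haa, inv_mul_cancel₀ (hm n).ne', ha1]
    simp
  have hBD : ∀ n x, B n (D n x) = x := fun n x => by
    rw [hD, hB, ContinuousLinearEquiv.symm_apply_apply, haa, mul_inv_cancel₀ (hm n).ne', ha1]
  have hDC : ∀ n z, D n z ∈ C ↔ a (m n)⁻¹ z ∈ C := fun n z => hγC n _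
  obtain ⟨M, hM⟩ : ∃ M, ∀ k ∈ K, ‖k‖ ≤ M ∧ η k ≤ M := by
    obtain ⟨M₁, h₁⟩ := hKc.exists_bound_of_continuousOn continuousOn_id
    obtain ⟨M₂, h₂⟩ := hKc.exists_bound_of_continuousOn η.continuous.continuousOn
    exact ⟨max M₁ M₂, fun k hk => ⟨(h₁ k hk).trans (le_max_left _ _),
      (le_abs_self _).trans ((h₂ k hk).trans (le_max_right _ _))⟩⟩
  have hDbound : ∀ n, ‖D n‖ ≤ 3 * M / r := by
    intro n
    refine opNorm_le_of_le_functional (φ := η) (x := w₀) hr (fun w hw => ?_) (hM _ (hγK n)).2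
    refine hη _ (subset_closure ((hDC n _).2 ?_))
    exact hanti _ _ 1 (hrball w hw).1 (by rw [ha1]; exact (hrball w hw).2) (hmi n) (hm1 n)
  -- The points `D n w₀` lie in `K`, so one radius serves for the bounds on all the inverses `B n`.
  obtain ⟨ρ, hρ, hρK⟩ : ∃ ρ : ℝ, 0 < ρ ∧ ∀ k ∈ K, ∀ w, ‖w‖ ≤ ρ → k + w ∈ C := by
    obtain ⟨ρ, hρ, h⟩ := hKc.exists_cthickening_subset_open hC.isOpen hKC
    refine ⟨ρ, hρ, fun k hk w hw => h ?_⟩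
    exact Metric.mem_cthickening_of_dist_le _ k _ _ hk (by simpa [dist_eq_norm] using hw)
  obtain ⟨M', hM'⟩ : ∃ M', ∀ n, (2 * κ) * (f + g) w₀ + η (a (m n)⁻¹ w₀) ≤ M' := by
    refine ⟨(2 * κ) * (f + g) w₀ + (|η (p w₀)| + |η (w₀ - p w₀)|), fun n => ?_⟩
    rw [ha, map_add, map_smul, smul_eq_mul]
    have h1 := le_abs_self (η (p w₀))
    have h2 : (m n)⁻¹ * η (w₀ - p w₀) ≤ |η (w₀ - p w₀)| :=
      calc (m n)⁻¹ * η (w₀ - p w₀) ≤ (m n)⁻¹ * |η (w₀ - p w₀)| :=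
            mul_le_mul_of_nonneg_left (le_abs_self _) (hmi n).le
        _ ≤ 1 * |η (w₀ - p w₀)| := by gcongr; exact hm1 n
        _ = _ := one_mul _
    linarith
  have hBbound : ∀ n, ‖B n‖ ≤ 3 * M' / ρ := by
    intro n
    -- `η` controls only the contracted point `a (m n)⁻¹ z`. The component z - pz, which the
    -- contraction shrinks, is controlled by f + g, which vanishes on V and is nonnegative there.
    refine opNorm_le_of_le_functional (φ := (2 * κ) • (f + g) + η.comp (a (m n)⁻¹))
      (x := D n w₀) hρ (fun w hw => ?_) ?_
    · set z := B n (D n w₀ + w) with hz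
      have hzC : a (m n)⁻¹ z ∈ C := by
        rw [← hDC, hz, hDB]
        exact hρK _ (hγK n) w hw
      have hfz : ∀ l : E →L[ℝ] ℝ, (∀ x ∈ C, 0 ≤ l x) → (∀ x, l (p x) = 0) → 0 ≤ l (z - p z) := by
        intro l hl hlp
        have := hl _ hzC
        rw [ha, map_add, hlp, zero_add, map_smul, smul_eq_mul] at this
        exact nonneg_of_mul_nonneg_right this (hmi n)
      have h1 := hfg (z - p z) (by simp [hpp]) (hfz f hf hfp) (hfz g hg hgp)
      have h2 : (f + g) (z - p z) = (f + g) z := by simp [hfp, hgp]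
      rw [h2] at h1
      have h3 := hη _ (subset_closure hzC)
      have h4 : z = a (m n)⁻¹ z + (1 - (m n)⁻¹) • (z - p z) := by
        rw [ha]; module
      have h5 : ‖(1 - (m n)⁻¹) • (z - p z)‖ ≤ ‖z - p z‖ := by
        rw [norm_smul, Real.norm_of_nonneg (by linarith [hm1 n])]
        exact mul_le_of_le_one_left (norm_nonneg _) (by linarith [hmi n])
      have h6 : ‖z‖ ≤ ‖a (m n)⁻¹ z‖ + ‖(1 - (m n)⁻¹) • (z - p z)‖ := by
        conv_lhs => rw [h4]
        exact norm_add_le _ _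
      have h7 := norm_nonneg (z - p z)
      have h8 : ((2 * κ) • (f + g) + η.comp (a (m n)⁻¹)) z
          = 2 * (κ * (f + g) z) + η (a (m n)⁻¹ z) := by
        simp; ring
      rw [h8]
      linarith
    · rw [hBD]
      simpa [mul_add] using hM' n
  -- passage to the limit
  obtain ⟨⟨D', B'⟩, -, φ, hφ, hlim⟩ := tendsto_subseq_of_bounded
    (s := Metric.closedBall (0 : (E →L[ℝ] E) × (E →L[ℝ] E)) (max (3 * M / r) (3 * M' / ρ)))
    Metric.isBounded_closedBall (x := fun n => (D n, B n)) (fun n => by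
      rw [mem_closedBall_zero_iff, Prod.norm_def]
      exact max_le_max (hDbound n) (hBbound n))
  have hDlim : Tendsto (fun n => D (φ n)) atTop (𝓝 D') := hlim.fst_nhds
  have hBlim : Tendsto (fun n => B (φ n)) atTop (𝓝 B') := hlim.snd_nhds
  have happ : ∀ {L : ℕ → E →L[ℝ] E} {L' : E →L[ℝ] E} {u : ℕ → E} {u' : E},
      Tendsto L atTop (𝓝 L') → Tendsto u atTop (𝓝 u') →
      Tendsto (fun n => L n (u n)) atTop (𝓝 (L' u')) := fun hL hu =>
    (isBoundedBilinearMap_apply.continuous.tendsto (_, _)).comp (hL.prodMk_nhds hu)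
  have hDlimz : ∀ z, Tendsto (fun n => D (φ n) z) atTop (𝓝 (D' z)) := fun z =>
    happ hDlim tendsto_const_nhds
  have hBlimz : ∀ z, Tendsto (fun n => B (φ n) z) atTop (𝓝 (B' z)) := fun z =>
    happ hBlim tendsto_const_nhds
  have hmlim : Tendsto (fun n => (m (φ n))⁻¹) atTop (𝓝 0) := by
    have : Tendsto (fun n : ℕ => 1 / ((n : ℝ) + 1)) atTop (𝓝 0) :=
      tendsto_one_div_add_atTop_nhds_zero_nat
    have := this.comp hφ.tendsto_atTop
    simpa [Function.comp_def, m] using this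
  refine hC.splits_of_limit (p := p) (D := D') (B := B') hpp ?_ ?_ (fun x => ?_) (fun x => ?_)
    (fun z hz => ?_) (fun z hz => ?_)
  · obtain ⟨x, hx, hx0⟩ := V.ne_bot_iff.1 hbot
    exact ⟨x, by rwa [hpid x hx]⟩
  · by_contra! h
    exact htop (V.eq_top_iff'.2 fun x => h x ▸ hpV x)
  · refine tendsto_nhds_unique (happ hDlim (hBlimz x)) ?_
    simp [hDB]
  · refine tendsto_nhds_unique (happ hBlim (hDlimz x)) ?_
    simp [hBD]
  · have hev : ∀ᶠ n in atTop, a (m (φ n))⁻¹ z ∈ C := by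
      filter_upwards [(hDlimz z).eventually_mem (hC.isOpen.mem_nhds hz)] with n hn
      exact (hDC _ _).1 hn
    constructor
    · have : Tendsto (fun n => a (m (φ n))⁻¹ z) atTop (𝓝 (p z)) := by
        simp only [ha]
        simpa using (hmlim.smul_const (z - p z)).const_add (p z)
      exact mem_closure_of_tendsto this hev
    · obtain ⟨n, hn⟩ := hev.exists
      exact ⟨_, hmi (φ n), by rwa [← ha]⟩
  · obtain ⟨t, ht, hmem⟩ := hz
    refine mem_closure_of_tendsto (hDlimz z) ?_
    filter_upwards [hmlim.eventually_le_const ht] with n hn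
    rw [hDC, ha]
    exact hmem _ (hmi _) hn

end Cones

/-! ### Flats as simplicial cones and their supporting functionals -/

section ConeFlats

variable {E : Type*} [NormedAddCommGroup E] [NormedSpace ℝ E] {C : Set E} {d : ℕ}

/-- The vectors `e i` span a simplicial cone that is properly embedded in the cone `C`. -/
structure IsConeFlat (C : Set E) (e : Fin d → E) : Prop where
  mem_closure : ∀ i, e i ∈ closure C
  sum_mem : ∑ i, e i ∈ C
  notMem : ∀ b : Fin d → ℝ, (∀ i, 0 ≤ b i) → ∀ j, b j = 0 → ∑ i, b i • e i ∉ C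

lemma IsSharpCone.sum_mem_closure (hC : IsSharpCone C) {ι : Type*} {s : Finset ι} {e : ι → E}
    (he : ∀ i ∈ s, e i ∈ closure C) : ∑ i ∈ s, e i ∈ closure C :=
  Finset.sum_induction _ (· ∈ closure C) (fun _ _ => hC.closure_add) hC.zero_mem_closure he

lemma IsSharpCone.sum_smul_mem_closure (hC : IsSharpCone C) {ι : Type*} [Fintype ι] {e : ι → E}
    (he : ∀ i, e i ∈ closure C) {b : ι → ℝ} (hb : ∀ i, 0 ≤ b i) :
    ∑ i, b i • e i ∈ closure C :=
  hC.sum_mem_closure fun i _ => hC.closure_smul (hb i) (he i)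

/-- If some combination of the `e i` lies in `C`, then all the positive combinations do. -/
lemma IsSharpCone.sum_pos_mem (hC : IsSharpCone C) {ι : Type*} [Fintype ι] {e : ι → E}
    (he : ∀ i, e i ∈ closure C) {a b : ι → ℝ} (ha : ∑ i, a i • e i ∈ C) (hb : ∀ i, 0 < b i) :
    ∑ i, b i • e i ∈ C := by
  obtain ⟨t, ht, htb⟩ : ∃ t : ℝ, 0 < t ∧ ∀ i, t * a i ≤ b i := by
    have h : ∀ᶠ t : ℝ in 𝓝[>] 0, ∀ i, t * a i < b i := by
      refine eventually_all.2 fun i => ?_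
      have : Tendsto (fun t : ℝ => t * a i) (𝓝[>] 0) (𝓝 0) := by
        refine ((continuous_id.mul continuous_const).tendsto' 0 0 ?_).mono_left nhdsWithin_le_nhds
        simp
      exact this.eventually_lt_const (hb i)
    obtain ⟨t, h, ht⟩ := (h.and self_mem_nhdsWithin).exists
    exact ⟨t, ht, fun i => (h i).le⟩
  have h1 : ∑ i, b i • e i = ∑ i, (b i - t * a i) • e i + t • ∑ i, a i • e i := by
    rw [Finset.smul_sum, ← Finset.sum_add_distrib]
    exact Finset.sum_congr rfl fun i _ => by module
  rw [h1]
  exact hC.closure_add_mem (hC.sum_smul_mem_closure he fun i => sub_nonneg.2 (htb i))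
    (hC.smul_mem ht ha)

namespace IsConeFlat

variable {e : Fin d → E}

lemma pos_of_sum_mem (he : IsConeFlat C e) {b : Fin d → ℝ} (hb : ∀ i, 0 ≤ b i)
    (h : ∑ i, b i • e i ∈ C) (i : Fin d) : 0 < b i :=
  (hb i).lt_of_ne fun h0 => he.notMem b hb i h0.symm h

lemma sum_pos_mem (he : IsConeFlat C e) (hC : IsSharpCone C) {b : Fin d → ℝ} (hb : ∀ i, 0 < b i) :
    ∑ i, b i • e i ∈ C :=
  hC.sum_pos_mem he.mem_closure (a := 1) (by simpa using he.sum_mem) hb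

/-- In a relation with a positive coefficient, let c j be the largest. Subtracting the relation
divided by c j from ∑ e i ∈ `C` leaves nonnegative coefficients with the j-th zero, contrary to
`notMem`. -/
lemma linearIndependent (he : IsConeFlat C e) : LinearIndependent ℝ e := by
  have key : ∀ c : Fin d → ℝ, ∑ i, c i • e i = 0 → ∀ i, c i ≤ 0 := by
    intro c hc i
    by_contra! hi
    obtain ⟨j, -, hj⟩ := Finset.exists_max_image Finset.univ c ⟨i, Finset.mem_univ i⟩
    have hj0 : 0 < c j := hi.trans_le (hj i (Finset.mem_univ i))
    refine he.notMem (fun i => 1 - c i / c j) (fun i => ?_) j ?_ ?_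
    · rw [sub_nonneg, div_le_one hj0]
      exact hj i (Finset.mem_univ i)
    · simp [hj0.ne']
    · have : ∑ i, (1 - c i / c j) • e i = ∑ i, e i - (c j)⁻¹ • ∑ i, c i • e i := by
        rw [Finset.smul_sum, ← Finset.sum_sub_distrib]
        exact Finset.sum_congr rfl fun i _ => by rw [smul_smul, inv_mul_eq_div, sub_smul, one_smul]
      rw [this, hc, smul_zero, sub_zero]
      exact he.sum_mem
  rw [Fintype.linearIndependent_iff]
  intro c hc i
  refine le_antisymm (key c hc i) ?_
  have := key (fun i => -c i) (by simpa using hc) i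
  simpa using this

/-- A functional supporting `C` at the barycentre of the facet is nonnegative at the vertices of the
facet, and their values sum to zero. -/
lemma exists_support (he : IsConeFlat C e) (hC : IsSharpCone C) (j : Fin d) :
    ∃ h : E →L[ℝ] ℝ, (∀ x ∈ C, 0 < h x) ∧ (∀ i, i ≠ j → h (e i) = 0) ∧ 0 < h (e j) := by
  set b : Fin d → ℝ := fun i => if i = j then 0 else 1 with hb
  have hb0 : ∀ i, 0 ≤ b i := fun i => by simp only [hb]; split_ifs <;> norm_num
  obtain ⟨h, hpos, h0⟩ := hC.exists_support (he.notMem b hb0 j (by simp [hb]))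
    (hC.sum_smul_mem_closure he.mem_closure hb0)
  have hnn : ∀ i, 0 ≤ h (e i) := fun i =>
    IsSharpCone.nonneg_of_mem_closure (fun x hx => (hpos x hx).le) (he.mem_closure i)
  have hz : ∀ i, i ≠ j → h (e i) = 0 := by
    simp only [map_sum, map_smul, smul_eq_mul] at h0
    rw [Finset.sum_eq_zero_iff_of_nonneg fun i _ => mul_nonneg (hb0 i) (hnn i)] at h0
    intro i hi
    simpa [hb, hi] using h0 i (Finset.mem_univ i)
  refine ⟨h, hpos, hz, ?_⟩
  have h1 := hpos _ he.sum_mem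
  rwa [map_sum, Finset.sum_eq_single j (fun i _ hi => hz i hi) (by simp)] at h1

lemma apply_sum {h : E →L[ℝ] ℝ} {j : Fin d} (hz : ∀ i, i ≠ j → h (e i) = 0) (b : Fin d → ℝ) :
    h (∑ i, b i • e i) = b j * h (e j) := by
  simp only [map_sum, map_smul, smul_eq_mul]
  exact Finset.sum_eq_single j (fun i _ hi => by rw [hz i hi, mul_zero]) (by simp)

lemma pos_apply (he : IsConeFlat C e) (hC : IsSharpCone C) {h : E →L[ℝ] ℝ}
    (hh : ∀ x ∈ C, 0 ≤ h x) (h0 : h ≠ 0) {j : Fin d} (hz : ∀ i, i ≠ j → h (e i) = 0) :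
    0 < h (e j) := by
  have := hC.pos_of_nonneg hh h0 he.sum_mem
  have h1 := apply_sum hz 1
  simp only [Pi.one_apply, one_smul, one_mul] at h1
  rwa [h1] at this

lemma nonneg_of_sum_mem_closure (he : IsConeFlat C e) (hC : IsSharpCone C) {b : Fin d → ℝ}
    (hb : ∑ i, b i • e i ∈ closure C) (j : Fin d) : 0 ≤ b j := by
  obtain ⟨h, hpos, hz, hj⟩ := he.exists_support hC j
  have := IsSharpCone.nonneg_of_mem_closure (fun x hx => (hpos x hx).le) hb
  rw [apply_sum hz] at this
  exact nonneg_of_mul_nonneg_left this hj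

/-- The vectors killed by supporting functionals along all the facets are transverse to the flat. -/
lemma eq_zero_of_mem_span {h : Fin d → E →L[ℝ] ℝ} (hz : ∀ j i, i ≠ j → h j (e i) = 0)
    (hpos : ∀ j, 0 < h j (e j)) {v : E} (hv : ∀ j, h j v = 0)
    (hspan : v ∈ Submodule.span ℝ (Set.range e)) : v = 0 := by
  obtain ⟨c, rfl⟩ := (Submodule.mem_span_range_iff_exists_fun ℝ).1 hspan
  refine Finset.sum_eq_zero fun i _ => ?_
  have := hv i
  rw [apply_sum (hz i)] at this
  rw [(mul_eq_zero.1 this).resolve_right (hpos i).ne', zero_smul]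

variable [FiniteDimensional ℝ E] (hd : Module.finrank ℝ E = d + 1)
include hd

lemma span_eq_ker (he : LinearIndependent ℝ e) {h : E →L[ℝ] ℝ} (h0 : h ≠ 0)
    (hz : ∀ i, h (e i) = 0) : Submodule.span ℝ (Set.range e) = LinearMap.ker h.toLinearMap := by
  apply Submodule.eq_of_le_of_finrank_eq
  · rw [Submodule.span_le]
    rintro _ ⟨i, rfl⟩
    exact hz i
  · have h1 := Module.Dual.finrank_ker_add_one_of_ne_zero (f := h.toLinearMap) (by
      intro h2
      exact h0 (ContinuousLinearMap.coe_injective h2))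
    rw [hd] at h1
    rw [finrank_span_eq_card he, Fintype.card_fin]
    exact (Nat.succ_injective h1).symm

lemma exists_functional (he : LinearIndependent ℝ e) :
    ∃ h : E →L[ℝ] ℝ, h ≠ 0 ∧ Submodule.span ℝ (Set.range e) = LinearMap.ker h.toLinearMap := by
  have hlt : Submodule.span ℝ (Set.range e) < ⊤ := by
    apply Submodule.lt_top_of_finrank_lt_finrank
    rw [finrank_span_eq_card he, Fintype.card_fin, hd]
    exact Nat.lt_succ_self d
  obtain ⟨f, hf, hle⟩ := Submodule.exists_le_ker_of_lt_top _ hlt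
  have hne : LinearMap.toContinuousLinearMap f ≠ 0 := by
    intro h
    exact hf (by simpa using h)
  exact ⟨LinearMap.toContinuousLinearMap f, hne, span_eq_ker hd he hne fun i =>
    hle (Submodule.subset_span ⟨i, rfl⟩)⟩

lemma exists_ne_zero_of_functionals (h : Fin d → E →L[ℝ] ℝ) : ∃ v ≠ 0, ∀ j, h j v = 0 := by
  have := LinearMap.ker_ne_bot_of_finrank_lt (f := LinearMap.pi fun j => (h j).toLinearMap) (by
    rw [hd, Module.finrank_fin_fun]
    exact Nat.lt_succ_self d)
  obtain ⟨v, hv, hv0⟩ := (Submodule.ne_bot_iff _).1 this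
  exact ⟨v, hv0, fun j => congr_fun hv j⟩

/-- A functional l defining the span of the flat cannot vanish at v. Subtracting the multiple of v
with the same value of l moves w into that span, where the `h j` have no common zero but 0. -/
lemma exists_eq_smul {h : Fin d → E →L[ℝ] ℝ} (he : LinearIndependent ℝ e)
    (hz : ∀ j i, i ≠ j → h j (e i) = 0)
    (hpos : ∀ j, 0 < h j (e j)) {v w : E} (hv : ∀ j, h j v = 0) (hw : ∀ j, h j w = 0)
    (hv0 : v ≠ 0) : ∃ c : ℝ, w = c • v := by
  obtain ⟨l, -, hl⟩ := exists_functional hd he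
  have hlv : l v ≠ 0 := fun h0 => hv0 (eq_zero_of_mem_span hz hpos hv (by rw [hl]; exact h0))
  refine ⟨l w / l v, ?_⟩
  rw [← sub_eq_zero]
  refine eq_zero_of_mem_span hz hpos (fun j => by simp [hv, hw]) ?_
  rw [hl, LinearMap.mem_ker]
  simp [hlv]

end IsConeFlat

/-! ### Supporting hyperplanes along facets, and crossing flats -/

section Faces

variable [FiniteDimensional ℝ E]

/-- The positive combinations are the image of the open orthant under a surjection onto the span,
hence open in it. -/
lemma IsSharpCone.exists_ball_span (hC : IsSharpCone C) {ι : Type*} [Fintype ι] {s : ι → E}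
    (hs : ∀ i, s i ∈ closure C) : ∃ δ : ℝ, 0 < δ ∧
      ∀ v ∈ Submodule.span ℝ (Set.range s), ‖v - ∑ i, s i‖ < δ → v ∈ closure C := by
  set V := Submodule.span ℝ (Set.range s)
  have hsV : ∀ i, s i ∈ V := fun i => Submodule.subset_span ⟨i, rfl⟩
  let L : (ι → ℝ) →ₗ[ℝ] V := Fintype.linearCombination ℝ (fun i => (⟨s i, hsV i⟩ : V))
  have hLapp : ∀ c, ((L c : V) : E) = ∑ i, c i • s i := fun c => by
    simp [L, Fintype.linearCombination_apply]
  have hLs : Function.Surjective L := by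
    rintro ⟨v, hv⟩
    obtain ⟨c, rfl⟩ := (Submodule.mem_span_range_iff_exists_fun ℝ).1 hv
    exact ⟨c, Subtype.ext (hLapp c)⟩
  have hopen : IsOpen (L '' {c | ∀ i, 0 < c i}) := by
    refine L.isOpenMap_of_finiteDimensional hLs _ ?_
    rw [Set.ofPred_forall]
    exact isOpen_iInter_of_finite fun i => isOpen_lt continuous_const (continuous_apply i)
  obtain ⟨δ, hδ, hball⟩ := Metric.isOpen_iff.1 hopen (L 1) ⟨1, by simp, rfl⟩
  refine ⟨δ, hδ, fun v hv hvδ => ?_⟩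
  obtain ⟨c, hc, hcv⟩ := hball (a := ⟨v, hv⟩) (by
    rw [Metric.mem_ball, Subtype.dist_eq, hLapp, dist_eq_norm]
    simpa using hvδ)
  have : v = ∑ i, c i • s i := by rw [← hLapp, hcv]
  rw [this]
  exact hC.sum_smul_mem_closure hs fun i => (hc i).le

/-- The form in which the blow-up is applied: with independent `f`, `g` to the span of a facet, and
with `g` = `f` to a supporting hyperplane. -/
lemma IsSharpCone.splits_of_span (hC : IsSharpCone C) (hK : IsCocompactCone C) {ι : Type*}
    [Fintype ι] {s : ι → E} (hs : ∀ i, s i ∈ closure C) (hs0 : ∃ i, s i ≠ 0) {f g : E →L[ℝ] ℝ}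
    (hf : ∀ x ∈ C, 0 ≤ f x) (hf0 : f ≠ 0) (hg : ∀ x ∈ C, 0 ≤ g x)
    (hV : ∀ x, x ∈ Submodule.span ℝ (Set.range s) ↔ f x = 0 ∧ g x = 0) : Splits C := by
  obtain ⟨δ, hδ, hball⟩ := hC.exists_ball_span hs
  obtain ⟨i, hi⟩ := hs0
  refine hC.splits_of_face hK (V := Submodule.span ℝ (Set.range s)) ?_ ?_
    (Submodule.sum_mem _ fun i _ => Submodule.subset_span ⟨i, rfl⟩) hδ hball hf hg hV
  · rw [Submodule.ne_bot_iff]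
    exact ⟨s i, Submodule.subset_span ⟨i, rfl⟩, hi⟩
  · intro htop
    apply hf0
    ext x
    exact ((hV x).1 (htop ▸ Submodule.mem_top)).1

/-- A facet of a flat has only one supporting hyperplane. -/
lemma IsConeFlat.support_unique {e : Fin d → E} (he : IsConeFlat C e) (hC : IsSharpCone C)
    (hK : IsCocompactCone C) (hsplit : ¬ Splits C) (hd : Module.finrank ℝ E = d + 1)
    (hd2 : 2 ≤ d) {f g : E →L[ℝ] ℝ} (hf : ∀ x ∈ C, 0 ≤ f x) (hf0 : f ≠ 0) (hg : ∀ x ∈ C, 0 ≤ g x)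
    {j : Fin d} (hfz : ∀ i, i ≠ j → f (e i) = 0) (hgz : ∀ i, i ≠ j → g (e i) = 0) :
    ∃ c : ℝ, g = c • f := by
  have hfj := he.pos_apply hC hf hf0 hfz
  have hgj : 0 ≤ g (e j) := IsSharpCone.nonneg_of_mem_closure hg (he.mem_closure j)
  -- With this factor g - cf vanishes at `e j` too. If it is nonzero, its kernel is the span of the
  -- flat, and ker f ∩ ker g is the span of the facet.
  set c := g (e j) / f (e j) with hc
  refine ⟨c, ?_⟩
  by_contra hne
  have hne' : g - c • f ≠ 0 := sub_ne_zero.2 hne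
  have hall : ∀ i, (g - c • f) (e i) = 0 := by
    intro i
    by_cases hij : i = j
    · subst hij
      simp [hc, hfj.ne']
    · simp [hfz i hij, hgz i hij]
  have hker := IsConeFlat.span_eq_ker hd he.linearIndependent hne' hall
  have : Nontrivial (Fin d) := Fin.nontrivial_iff_two_le.2 hd2
  obtain ⟨i₀, hi₀⟩ := exists_ne j
  refine hsplit (hC.splits_of_span hK (s := fun i : {i // i ≠ j} => e i)
    (fun i => he.mem_closure i) ⟨⟨i₀, hi₀⟩, he.linearIndependent.ne_zero i₀⟩ hf hf0 hg fun x => ?_)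
  constructor
  · intro hx
    have hle : Submodule.span ℝ (Set.range fun i : {i // i ≠ j} => e i) ≤
        LinearMap.ker f.toLinearMap ⊓ LinearMap.ker g.toLinearMap := by
      rw [Submodule.span_le]
      rintro _ ⟨i, rfl⟩
      exact ⟨hfz i i.2, hgz i i.2⟩
    exact hle hx
  · rintro ⟨hfx, hgx⟩
    have hx : x ∈ Submodule.span ℝ (Set.range e) := by
      rw [hker, LinearMap.mem_ker]
      simp [hfx, hgx]
    obtain ⟨b, rfl⟩ := (Submodule.mem_span_range_iff_exists_fun ℝ).1 hx
    rw [IsConeFlat.apply_sum hfz] at hfx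
    have hbj : b j = 0 := (mul_eq_zero.1 hfx).resolve_right hfj.ne'
    refine Submodule.sum_mem _ fun i _ => ?_
    by_cases hij : i = j
    · rw [hij, hbj, zero_smul]
      exact Submodule.zero_mem _
    · exact Submodule.smul_mem _ _ (Submodule.subset_span ⟨⟨i, hij⟩, rfl⟩)

/-- Two flats which cross each other span the same hyperplane. -/
theorem IsConeFlat.span_eq_of_sum_eq {e e' : Fin d → E} (he : IsConeFlat C e)
    (he' : IsConeFlat C e') (hC : IsSharpCone C) (hK : IsCocompactCone C) (hsplit : ¬ Splits C)
    (hd : Module.finrank ℝ E = d + 1) (hd3 : 3 ≤ d) {a a' : Fin d → ℝ} (ha : ∀ i, 0 < a i)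
    (haa : ∑ i, a i • e i = ∑ i, a' i • e' i) :
    Submodule.span ℝ (Set.range e) = Submodule.span ℝ (Set.range e') := by
  obtain ⟨l, hl0, hl⟩ := IsConeFlat.exists_functional hd he'.linearIndependent
  have hle' : ∀ i, l (e' i) = 0 := fun i => by
    have : e' i ∈ LinearMap.ker l.toLinearMap := hl ▸ Submodule.subset_span ⟨i, rfl⟩
    exact this
  by_cases hall : ∀ i, l (e i) = 0
  · rw [hl, IsConeFlat.span_eq_ker hd he.linearIndependent hl0 hall]
  exfalso
  push Not at hall
  obtain ⟨i₀, hi₀⟩ := hall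
  have hsum : ∑ i, a i * l (e i) = 0 := by
    have := congrArg l haa
    simpa [hle'] using this
  -- The common point has positive coordinates along `e` and lies in ker l, so `l` takes both signs
  -- on the vertices.
  obtain ⟨p, -, hp⟩ := Finset.exists_pos_of_sum_zero_of_exists_nonzero _ hsum
    ⟨i₀, Finset.mem_univ _, mul_ne_zero (ha i₀).ne' hi₀⟩
  obtain ⟨n, -, hn⟩ := Finset.exists_pos_of_sum_zero_of_exists_nonzero
    (fun i => -(a i * l (e i))) (by rw [Finset.sum_neg_distrib, hsum, neg_zero])
    ⟨i₀, Finset.mem_univ _, neg_ne_zero.2 (mul_ne_zero (ha i₀).ne' hi₀)⟩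
  replace hp : 0 < l (e p) := pos_of_mul_pos_right hp (ha p).le
  replace hn : l (e n) < 0 := by
    have h1 : a n * l (e n) < 0 := neg_pos.1 hn
    exact neg_of_mul_neg_right h1 (ha n).le
  -- Since d ≥ 3, some facet of the first flat contains both a vertex with l > 0 and one with l < 0,
  -- so ker l meets its relative interior.
  obtain ⟨k, hk⟩ : ∃ k : Fin d, k ∉ ({p, n} : Finset (Fin d)) := by
    by_contra! h
    have h1 : (Finset.univ : Finset (Fin d)).card ≤ ({p, n} : Finset (Fin d)).card :=
      Finset.card_le_card fun i _ => h i
    rw [Finset.card_univ, Fintype.card_fin] at h1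
    have := Finset.card_le_two (a := p) (b := n)
    omega
  simp only [Finset.mem_insert, Finset.mem_singleton, not_or] at hk
  -- a point of the facet opposite to `e k` in the span of the other flat
  obtain ⟨b, hb, hbk, hbl⟩ : ∃ b : Fin d → ℝ, (∀ i, i ≠ k → 0 < b i) ∧ b k = 0 ∧
      ∑ i, b i * l (e i) = 0 := by
    set b₀ : Fin d → ℝ := fun i => if i = k then 0 else 1 with hb₀
    set σ := ∑ i, b₀ i * l (e i) with hσ
    -- Starting from the barycentre of the facet, the weight of a vertex of the appropriate sign is
    -- raised until `l` vanishes.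
    have main : ∀ q, q ≠ k → l (e q) ≠ 0 → 0 ≤ -σ / l (e q) → ∃ b : Fin d → ℝ,
        (∀ i, i ≠ k → 0 < b i) ∧ b k = 0 ∧ ∑ i, b i * l (e i) = 0 := by
      intro q hqk hq hqσ
      refine ⟨fun i => b₀ i + if i = q then -σ / l (e q) else 0, fun i hi => ?_, ?_, ?_⟩
      · have : b₀ i = 1 := by simp [hb₀, hi]
        simp only [this]
        split_ifs <;> linarith
      · simp [hb₀, hqk.symm]
      · simp only [add_mul, Finset.sum_add_distrib, ite_mul, zero_mul, Finset.sum_ite_eq',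
          Finset.mem_univ, if_true]
        rw [← hσ, div_mul_cancel₀ _ hq]
        ring
    rcases le_total σ 0 with h | h
    · exact main p (Ne.symm hk.1) hp.ne' (div_nonneg (by linarith) hp.le)
    · exact main n (Ne.symm hk.2) hn.ne (div_nonneg_of_nonpos (by linarith) hn.le)
  have hb0 : ∀ i, 0 ≤ b i := fun i => by
    by_cases hi : i = k
    · rw [hi, hbk]
    · exact (hb i hi).le
  set z := ∑ i, b i • e i with hz
  have hzc : z ∈ closure C := hC.sum_smul_mem_closure he.mem_closure hb0
  have hzC : z ∉ C := he.notMem b hb0 k hbk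
  obtain ⟨b', hb'⟩ : ∃ b' : Fin d → ℝ, ∑ i, b' i • e' i = z := by
    rw [← Submodule.mem_span_range_iff_exists_fun, hl, LinearMap.mem_ker]
    simpa [hz] using hbl
  have hb'0 : ∀ i, 0 ≤ b' i := he'.nonneg_of_sum_mem_closure hC (hb' ▸ hzc)
  choose h hpos hvan hdiag using fun j => he'.exists_support hC j
  have hhnn : ∀ j, ∀ x ∈ C, 0 ≤ h j x := fun j x hx => (hpos j x hx).le
  have hh0 : ∀ j, h j ≠ 0 := fun j h0 => by
    have := hdiag j
    rw [h0] at this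
    exact lt_irrefl _ this
  -- a supporting functional of the second flat vanishing at `z` supports the facet of the first one
  have hfacet : ∀ j, b' j = 0 → ∀ i, i ≠ k → h j (e i) = 0 := by
    intro j hj
    have h1 : h j z = 0 := by rw [← hb', IsConeFlat.apply_sum (hvan j), hj, zero_mul]
    simp only [hz, map_sum, map_smul, smul_eq_mul] at h1
    rw [Finset.sum_eq_zero_iff_of_nonneg fun i _ => mul_nonneg (hb0 i)
      (IsSharpCone.nonneg_of_mem_closure (hhnn j) (he.mem_closure i))] at h1
    intro i hi
    exact (mul_eq_zero.1 (h1 i (Finset.mem_univ i))).resolve_left (hb i hi).ne'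
  -- `z` is not in `C`, so it cannot have all coordinates positive along the second flat.
  obtain ⟨j, hj⟩ : ∃ j, b' j = 0 := by
    by_contra! hne
    exact hzC (hb' ▸ he'.sum_pos_mem hC fun i => (hb'0 i).lt_of_ne (hne i).symm)
  -- The facet of the second flat has rank d - 1, and the vertex `e p` lies outside its span because
  -- l(e p) ≠ 0. So the two facets together fill the d-dimensional kernel.
  have hrange : LinearMap.ker (h j).toLinearMap = Submodule.span ℝ
      (Set.range (Sum.elim (fun i : {i // i ≠ k} => e i) (fun i : {i // i ≠ j} => e' i))) := by
    set s := Sum.elim (fun i : {i // i ≠ k} => e i) (fun i : {i // i ≠ j} => e' i)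
    have hle : Submodule.span ℝ (Set.range s) ≤ LinearMap.ker (h j).toLinearMap := by
      rw [Submodule.span_le]
      rintro _ ⟨i | i, rfl⟩
      · exact hfacet j hj i i.2
      · exact hvan j i i.2
    symm
    apply Submodule.eq_of_le_of_finrank_eq hle
    apply le_antisymm (Submodule.finrank_mono hle)
    have h1 := Module.Dual.finrank_ker_add_one_of_ne_zero (f := (h j).toLinearMap) (by
      intro h2
      exact hh0 j (ContinuousLinearMap.coe_injective h2))
    have h2 : Module.finrank ℝ (Submodule.span ℝ (Set.range fun i : {i // i ≠ j} => e' i)) <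
        Module.finrank ℝ (Submodule.span ℝ (Set.range s)) := by
      apply Submodule.finrank_lt_finrank_of_lt
      refine lt_of_le_of_ne (Submodule.span_mono ?_) fun heq => ?_
      · rintro _ ⟨i, rfl⟩
        exact ⟨Sum.inr i, rfl⟩
      · have h3 : e p ∈ Submodule.span ℝ (Set.range fun i : {i // i ≠ j} => e' i) := by
          rw [heq]
          exact Submodule.subset_span ⟨Sum.inl ⟨p, Ne.symm hk.1⟩, rfl⟩
        have h4 : Submodule.span ℝ (Set.range fun i : {i // i ≠ j} => e' i) ≤
            LinearMap.ker l.toLinearMap := by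
          rw [Submodule.span_le]
          rintro _ ⟨i, rfl⟩
          exact hle' i
        have h5 : l (e p) = 0 := h4 h3
        exact hp.ne' h5
    have h3 := finrank_span_eq_card (he'.linearIndependent.comp
      (Subtype.val : {i // i ≠ j} → Fin d) Subtype.val_injective)
    simp only [Function.comp_def] at h3
    rw [h3, Fintype.card_subtype_compl, Fintype.card_fin, Fintype.card_subtype_eq] at h2
    omega
  refine hsplit (hC.splits_of_span hK
    (s := Sum.elim (fun i : {i // i ≠ k} => e i) (fun i : {i // i ≠ j} => e' i)) ?_
    ⟨Sum.inl ⟨p, Ne.symm hk.1⟩, he.linearIndependent.ne_zero p⟩ (hhnn j) (hh0 j) (hhnn j) ?_)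
  · rintro (i | i)
    · exact he.mem_closure i
    · exact he'.mem_closure i
  · intro x
    rw [← hrange, and_self]
    rfl

end Faces

end ConeFlats

/-! ### Pairs of nearby flats and the compactness argument -/

section NearbyFlats

variable {E : Type*} [NormedAddCommGroup E] [NormedSpace ℝ E] {C : Set E} {d : ℕ}

/-- `h j` is a supporting functional of `C` along the facet of the flat `e` opposite to `e j`. -/
def IsSupportFamily (C : Set E) (e : Fin d → E) (h : Fin d → E →L[ℝ] ℝ) : Prop :=
  ∀ j, (∀ x ∈ C, 0 ≤ h j x) ∧ h j ≠ 0 ∧ ∀ i, i ≠ j → h j (e i) = 0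

/-- Two flats with points `∑ a i • e i`, `∑ a' i • e' i` at distance controlled by `ε`, together
with supporting functionals along the facets of the first flat and a common zero `v` of them. -/
structure NearbyFlats (C : Set E) (ε : ℝ) (e e' : Fin d → E) (a a' : Fin d → ℝ)
    (h : Fin d → E →L[ℝ] ℝ) (v : E) : Prop where
  flat : IsConeFlat C e
  flat' : IsConeFlat C e'
  nonneg : ∀ i, 0 ≤ a i
  nonneg' : ∀ i, 0 ≤ a' i
  mem : ∑ i, a i • e i ∈ C
  le : ∑ i, a' i • e' i - ∑ i, a i • e i ∈ closure C
  ge : (1 + ε) • ∑ i, a i • e i - ∑ i, a' i • e' i ∈ closure C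
  support : IsSupportFamily C e h
  ne_zero : v ≠ 0
  apply_eq_zero : ∀ j, h j v = 0

/-- The line through `x` in the direction `v` meets the simplicial cone spanned by `e'`. -/
def MeetsSimplex (x v : E) (e' : Fin d → E) : Prop :=
  ∃ (τ : ℝ) (b : Fin d → ℝ), (∀ i, 0 < b i) ∧ x + τ • v = ∑ i, b i • e' i

lemma IsConeFlat.map {e : Fin d → E} (he : IsConeFlat C e) (g : E ≃L[ℝ] E)
    (hg : ∀ y, g y ∈ C ↔ y ∈ C) : IsConeFlat C (fun i => g (e i)) where
  mem_closure i := map_mem_closure g.continuous (he.mem_closure i) fun y hy => (hg y).2 hy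
  sum_mem := by
    rw [← map_sum, hg]
    exact he.sum_mem
  notMem b hb j hj := by
    have : ∑ i, b i • g (e i) = g (∑ i, b i • e i) := by simp
    rw [this, hg]
    exact he.notMem b hb j hj

lemma IsConeFlat.smul {e : Fin d → E} (he : IsConeFlat C e) (hC : IsSharpCone C) {c : Fin d → ℝ}
    (hc : ∀ i, 0 < c i) : IsConeFlat C (fun i => c i • e i) where
  mem_closure i := hC.closure_smul_pos (hc i) (he.mem_closure i)
  sum_mem := he.sum_pos_mem hC hc
  notMem b hb j hj := by
    simp only [smul_smul]
    exact he.notMem _ (fun i => mul_nonneg (hb i) (hc i).le) j (by simp [hj])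

namespace NearbyFlats

variable {ε : ℝ} {e e' : Fin d → E} {a a' : Fin d → ℝ} {h : Fin d → E →L[ℝ] ℝ} {v : E}

lemma map (H : NearbyFlats C ε e e' a a' h v) (g : E ≃L[ℝ] E) (hg : ∀ y, g y ∈ C ↔ y ∈ C) :
    NearbyFlats C ε (fun i => g (e i)) (fun i => g (e' i)) a a'
      (fun j => (h j).comp (g.symm : E →L[ℝ] E)) (g v) where
  flat := H.flat.map g hg
  flat' := H.flat'.map g hg
  nonneg := H.nonneg
  nonneg' := H.nonneg'
  mem := by
    have := (hg _).2 H.mem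
    simpa using this
  le := by
    have := map_mem_closure g.continuous H.le fun y hy => (hg y).2 hy
    simpa using this
  ge := by
    have := map_mem_closure g.continuous H.ge fun y hy => (hg y).2 hy
    simpa using this
  support j := by
    refine ⟨fun x hx => (H.support j).1 _ ?_, fun h0 => (H.support j).2.1 ?_, fun i hi => ?_⟩
    · rw [← hg]
      simpa using hx
    · ext x
      simpa using DFunLike.congr_fun h0 (g x)
    · simpa using (H.support j).2.2 i hi
  ne_zero := by simpa using H.ne_zero
  apply_eq_zero j := by simpa using H.apply_eq_zero j

/-- Unit vectors and functionals keep the data bounded and prevent their limits from vanishing; the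
marked points do not change. -/
lemma normalize (H : NearbyFlats C ε e e' a a' h v) (hC : IsSharpCone C) :
    NearbyFlats C ε (fun i => ‖e i‖⁻¹ • e i) (fun i => ‖e' i‖⁻¹ • e' i) (fun i => ‖e i‖ * a i)
      (fun i => ‖e' i‖ * a' i) (fun j => ‖h j‖⁻¹ • h j) (‖v‖⁻¹ • v) := by
  have hpos : ∀ {e : Fin d → E}, IsConeFlat C e → ∀ i, 0 < ‖e i‖ := fun he i =>
    norm_pos_iff.2 (he.linearIndependent.ne_zero i)
  have hsum : ∀ {e : Fin d → E}, IsConeFlat C e → ∀ a : Fin d → ℝ,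
      ∑ i, (‖e i‖ * a i) • ‖e i‖⁻¹ • e i = ∑ i, a i • e i := fun he a =>
    Finset.sum_congr rfl fun i _ => by
      rw [smul_smul]
      congr 1
      field_simp [(hpos he i).ne']
  have hh : ∀ j, 0 < ‖h j‖ := fun j => norm_pos_iff.2 (H.support j).2.1
  have hv : 0 < ‖v‖ := norm_pos_iff.2 H.ne_zero
  refine ⟨H.flat.smul hC fun i => inv_pos.2 (hpos H.flat i),
    H.flat'.smul hC fun i => inv_pos.2 (hpos H.flat' i),
    fun i => mul_nonneg (norm_nonneg _) (H.nonneg i),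
    fun i => mul_nonneg (norm_nonneg _) (H.nonneg' i), ?_, ?_, ?_, fun j => ⟨fun x hx => ?_, ?_,
    fun i hi => ?_⟩, ?_, fun j => ?_⟩
  · rw [hsum H.flat]; exact H.mem
  · rw [hsum H.flat, hsum H.flat']; exact H.le
  · rw [hsum H.flat, hsum H.flat']; exact H.ge
  · exact mul_nonneg (inv_pos.2 (hh j)).le ((H.support j).1 x hx)
  · exact smul_ne_zero (inv_pos.2 (hh j)).ne' (H.support j).2.1
  · simp [(H.support j).2.2 i hi]
  · exact smul_ne_zero (inv_pos.2 hv).ne' H.ne_zero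
  · simp [H.apply_eq_zero j]

end NearbyFlats

lemma MeetsSimplex.of_map {x v : E} {e' : Fin d → E} (g : E ≃L[ℝ] E)
    (H : MeetsSimplex (g x) (g v) (fun i => g (e' i))) : MeetsSimplex x v e' := by
  obtain ⟨τ, b, hb, h⟩ := H
  exact ⟨τ, b, hb, g.injective (by simpa using h)⟩

lemma MeetsSimplex.of_smul {x v : E} {e' : Fin d → E} {c : Fin d → ℝ} {t : ℝ} (hc : ∀ i, 0 < c i)
    (H : MeetsSimplex x (t • v) (fun i => c i • e' i)) : MeetsSimplex x v e' := by
  obtain ⟨τ, b, hb, h⟩ := H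
  exact ⟨τ * t, fun i => b i * c i, fun i => mul_pos (hb i) (hc i), by simpa [smul_smul] using h⟩

/-- A limit of flats with marked points converging inside the cone is a flat. -/
lemma IsConeFlat.of_tendsto (hC : IsSharpCone C) {e : ℕ → Fin d → E} {e₀ : Fin d → E}
    {a : Fin d → ℝ} (he : ∀ n, IsConeFlat C (e n)) (hlim : Tendsto e atTop (𝓝 e₀))
    (hmem : ∑ i, a i • e₀ i ∈ C) : IsConeFlat C e₀ := by
  have hcl : ∀ i, e₀ i ∈ closure C := fun i =>
    isClosed_closure.mem_of_tendsto (tendsto_pi_nhds.1 hlim i)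
      (Eventually.of_forall fun n => (he n).mem_closure i)
  -- Avoiding the open set `C` is a closed condition. Degeneration of the simplices is thereby
  -- excluded as well, since linear independence follows from the properties of a flat.
  have hnot : ∀ b : Fin d → ℝ, (∀ i, 0 ≤ b i) → ∀ j, b j = 0 → ∑ i, b i • e₀ i ∉ C := by
    intro b hb j hj
    refine hC.isOpen.isClosed_compl.mem_of_tendsto (x := ∑ i, b i • e₀ i)
      (tendsto_finsetSum _ fun i _ => (tendsto_pi_nhds.1 hlim i).const_smul (b i))
      (Eventually.of_forall fun n => (he n).notMem b hb j hj)
  refine ⟨hcl, ?_, hnot⟩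
  simpa using hC.sum_pos_mem hcl hmem (b := 1) (by simp)

variable [FiniteDimensional ℝ E]

/-- Bases depend continuously on parameters: if `x` has positive coordinates along `e'` in the basis
`(e', v)`, then so do nearby points in nearby bases. -/
lemma eventually_meetsSimplex {d : ℕ} (hd : Module.finrank ℝ E = d + 1) {x : ℕ → E}
    {v : ℕ → E} {e' : ℕ → Fin d → E} {x₀ v₀ : E} {e₀ : Fin d → E} (hx : Tendsto x atTop (𝓝 x₀))
    (hv : Tendsto v atTop (𝓝 v₀)) (he : Tendsto e' atTop (𝓝 e₀)) (hli : LinearIndependent ℝ e₀)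
    (hv₀ : v₀ ∉ Submodule.span ℝ (Set.range e₀)) {b : Fin d → ℝ} (hb : ∀ i, 0 < b i)
    (hxb : x₀ = ∑ i, b i • e₀ i) : ∀ᶠ n in atTop, MeetsSimplex (x n) (v n) (e' n) := by
  -- `T` sends coordinates to the point with these coordinates along (e', v). It is invertible at
  -- the limit, and inversion of operators is continuous there.
  let T : (Fin d → E) × E → ((Fin d → ℝ) × ℝ →L[ℝ] E) := fun p =>
    ∑ i, ((ContinuousLinearMap.proj i).comp (ContinuousLinearMap.fst ℝ (Fin d → ℝ) ℝ)).smulRight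
      (p.1 i) + (ContinuousLinearMap.snd ℝ (Fin d → ℝ) ℝ).smulRight p.2
  have hT : ∀ p z, T p z = ∑ i, z.1 i • p.1 i + z.2 • p.2 := by
    intro p z
    simp [T]
  have hTc : Continuous T := by
    rw [continuous_clm_apply]
    intro z
    simp only [hT]
    fun_prop
  have hinj : Function.Injective (T (e₀, v₀)) := by
    rw [injective_iff_map_eq_zero]
    rintro ⟨c, τ⟩ h0
    rw [hT] at h0
    simp only at h0
    have hτ : τ = 0 := by
      by_contra hτ
      apply hv₀
      have : v₀ = (-τ⁻¹) • ∑ i, c i • e₀ i := by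
        rw [eq_neg_of_add_eq_zero_left h0]
        simp [smul_smul, hτ]
      rw [this]
      exact Submodule.smul_mem _ _ (Submodule.sum_mem _ fun i _ =>
        Submodule.smul_mem _ _ (Submodule.subset_span ⟨i, rfl⟩))
    subst hτ
    rw [zero_smul, add_zero] at h0
    have := Fintype.linearIndependent_iff.1 hli c h0
    ext i
    · exact this i
    · rfl
  let S : ((Fin d → ℝ) × ℝ) ≃L[ℝ] E := (LinearEquiv.ofInjectiveOfFinrankEq
    (T (e₀, v₀)).toLinearMap hinj (by simp [hd])).toContinuousLinearEquiv
  have hS : (S : (Fin d → ℝ) × ℝ →L[ℝ] E) = T (e₀, v₀) := by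
    ext z <;> rfl
  have hTn : Tendsto (fun n => T (e' n, v n)) atTop (𝓝 (S : (Fin d → ℝ) × ℝ →L[ℝ] E)) := by
    rw [hS]
    exact (hTc.tendsto _).comp (he.prodMk_nhds hv)
  have hinv : Tendsto (fun n => ContinuousLinearMap.inverse (T (e' n, v n)) (x n)) atTop
      (𝓝 (S.symm x₀)) := by
    have h1 := (contDiffAt_map_inverse (𝕜 := ℝ) (n := 0) S).continuousAt.tendsto.comp hTn
    rw [ContinuousLinearMap.inverse_equiv] at h1
    exact (isBoundedBilinearMap_apply.continuous.tendsto (_, _)).comp (h1.prodMk_nhds hx)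
  have hSx : S.symm x₀ = (b, 0) := by
    rw [ContinuousLinearEquiv.symm_apply_eq]
    have : S (b, 0) = T (e₀, v₀) (b, 0) := rfl
    rw [this, hT, hxb]
    simp
  rw [hSx] at hinv
  have hpos : ∀ᶠ n in atTop, ∀ i,
      0 < (ContinuousLinearMap.inverse (T (e' n, v n)) (x n)).1 i :=
    eventually_all.2 fun i => (tendsto_pi_nhds.1 hinv.fst_nhds i).eventually_const_lt (hb i)
  filter_upwards [hpos, hTn.eventually (ContinuousLinearEquiv.nhds S)] with n hn hSn
  obtain ⟨R, hR⟩ := hSn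
  refine ⟨-(ContinuousLinearMap.inverse (T (e' n, v n)) (x n)).2, _, hn, ?_⟩
  have h1 : T (e' n, v n) (ContinuousLinearMap.inverse (T (e' n, v n)) (x n)) = x n := by
    rw [← hR, ContinuousLinearMap.inverse_equiv]
    simp
  rw [hT] at h1
  simp only at h1
  rw [neg_smul, ← sub_eq_add_neg, sub_eq_iff_eq_add]
  exact h1.symm

-- Each summand is dominated in `η` by the whole sum, and x ≤ y ≤ (1 + ε)x with ε ≤ 1 gives η y ≤ 2
-- η x.
omit [FiniteDimensional ℝ E] in
lemma NearbyFlats.bound {K : Set E} {η : E →L[ℝ] ℝ} (hC : IsSharpCone C)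
    (hη : ∀ x ∈ closure C, ‖x‖ ≤ η x) {M ε : ℝ} (hM : ∀ k ∈ K, η k ≤ M) (hε : ε ≤ 1)
    {e e' : Fin d → E} {a a' : Fin d → ℝ} {h : Fin d → E →L[ℝ] ℝ} {v : E}
    (H : NearbyFlats C ε e e' a a' h v) (hK : ∑ i, a i • e i ∈ K) (hn : ∀ i, ‖e i‖ = 1)
    (hn' : ∀ i, ‖e' i‖ = 1) : (∀ i, a i ≤ 2 * M) ∧ ∀ i, a' i ≤ 2 * M := by
  have hη0 : ∀ x ∈ closure C, 0 ≤ η x := fun x hx => (norm_nonneg x).trans (hη x hx)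
  have key : ∀ (e : Fin d → E) (a : Fin d → ℝ), IsConeFlat C e → (∀ i, 0 ≤ a i) →
      (∀ i, ‖e i‖ = 1) → ∀ i, a i ≤ η (∑ i, a i • e i) := by
    intro e a he ha hn i
    have hmem : ∀ i, a i • e i ∈ closure C := fun i => hC.closure_smul (ha i) (he.mem_closure i)
    calc a i = ‖a i • e i‖ := by rw [norm_smul, hn, mul_one, Real.norm_of_nonneg (ha i)]
      _ ≤ η (a i • e i) := hη _ (hmem i)
      _ ≤ ∑ i, η (a i • e i) :=
          Finset.single_le_sum (f := fun i => η (a i • e i)) (fun i _ => hη0 _ (hmem i))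
            (Finset.mem_univ i)
      _ = _ := (map_sum _ _ _).symm
  have hx := hM _ hK
  have hx0 := hη0 _ (subset_closure H.mem)
  have hy := hη0 _ H.ge
  rw [map_sub, map_smul, smul_eq_mul] at hy
  refine ⟨fun i => (key e a H.flat H.nonneg hn i).trans (by linarith), fun i =>
    (key e' a' H.flat' H.nonneg' hn' i).trans ?_⟩
  nlinarith

theorem exists_eps_of_isCompact {K : Set E} (hC : IsSharpCone C) (hcc : IsCocompactCone C)
    (hsplit : ¬ Splits C) (hd : Module.finrank ℝ E = d + 1) (hd3 : 3 ≤ d) (hKC : K ⊆ C)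
    (hK : IsCompact K) : ∃ ε : ℝ, 0 < ε ∧ ∀ e e' a a' h v,
      NearbyFlats C ε (d := d) e e' a a' h v → ∑ i, a i • e i ∈ K → (∀ i, ‖e i‖ = 1) →
      (∀ i, ‖e' i‖ = 1) → (∀ j, ‖h j‖ = 1) → ‖v‖ = 1 → MeetsSimplex (∑ i, a i • e i) v e' := by
  obtain ⟨η, hη⟩ := hC.exists_norm_le
  obtain ⟨M, hM⟩ : ∃ M, ∀ k ∈ K, η k ≤ M := by
    obtain ⟨M, h⟩ := hK.exists_bound_of_continuousOn η.continuous.continuousOn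
    exact ⟨M, fun k hk => (le_abs_self _).trans (h k hk)⟩
  by_contra! hcon
  choose e e' a a' h v H hHK hne hne' hnh hnv hbad using
    fun n : ℕ => hcon (1 / ((n : ℝ) + 1)) (by positivity)
  have hbd := fun n => (H n).bound hC hη hM (by
    rw [div_le_one (by positivity)]; simp) (hHK n) (hne n) (hne' n)
  set R := max 1 (2 * M)
  have hR : 0 ≤ R := zero_le_one.trans (le_max_left _ _)
  have hR1 : (1 : ℝ) ≤ R := le_max_left _ _
  have hRM : 2 * M ≤ R := le_max_right _ _
  obtain ⟨⟨e₀, e₀', a₀, a₀', h₀, v₀⟩, -, φ, hφ, hlim⟩ := tendsto_subseq_of_bounded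
    (s := Metric.closedBall (0 : (Fin d → E) × (Fin d → E) × (Fin d → ℝ) × (Fin d → ℝ) ×
      (Fin d → E →L[ℝ] ℝ) × E) R)
    Metric.isBounded_closedBall (x := fun n => (e n, e' n, a n, a' n, h n, v n)) (fun n => by
      rw [mem_closedBall_zero_iff]
      simp only [Prod.norm_def, max_le_iff]
      refine ⟨(pi_norm_le_iff_of_nonneg hR).2 fun i => (hne n i).trans_le hR1, (pi_norm_le_iff_of_nonneg hR).2 fun i => (hne' n i).trans_le hR1,
        (pi_norm_le_iff_of_nonneg hR).2 fun i => ?_, (pi_norm_le_iff_of_nonneg hR).2 fun i => ?_, (pi_norm_le_iff_of_nonneg hR).2 fun i => (hnh n i).trans_le hR1,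
        (hnv n).trans_le hR1⟩
      · rw [Real.norm_of_nonneg ((H n).nonneg i)]
        exact ((hbd n).1 i).trans hRM
      · rw [Real.norm_of_nonneg ((H n).nonneg' i)]
        exact ((hbd n).2 i).trans hRM)
  have he₀ : Tendsto (fun n => e (φ n)) atTop (𝓝 e₀) := hlim.fst_nhds
  have he₀' : Tendsto (fun n => e' (φ n)) atTop (𝓝 e₀') := hlim.snd_nhds.fst_nhds
  have ha₀ : Tendsto (fun n => a (φ n)) atTop (𝓝 a₀) := hlim.snd_nhds.snd_nhds.fst_nhds
  have ha₀' : Tendsto (fun n => a' (φ n)) atTop (𝓝 a₀') := hlim.snd_nhds.snd_nhds.snd_nhds.fst_nhds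
  have hh₀ : Tendsto (fun n => h (φ n)) atTop (𝓝 h₀) :=
    hlim.snd_nhds.snd_nhds.snd_nhds.snd_nhds.fst_nhds
  have hv₀ : Tendsto (fun n => v (φ n)) atTop (𝓝 v₀) :=
    hlim.snd_nhds.snd_nhds.snd_nhds.snd_nhds.snd_nhds
  have hsum : ∀ {b : ℕ → Fin d → ℝ} {b₀ : Fin d → ℝ} {f : ℕ → Fin d → E} {f₀ : Fin d → E},
      Tendsto b atTop (𝓝 b₀) → Tendsto f atTop (𝓝 f₀) →
      Tendsto (fun n => ∑ i, b n i • f n i) atTop (𝓝 (∑ i, b₀ i • f₀ i)) := fun hb hf =>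
    tendsto_finsetSum _ fun i _ => (tendsto_pi_nhds.1 hb i).smul (tendsto_pi_nhds.1 hf i)
  have hx := hsum ha₀ he₀
  have hy := hsum ha₀' he₀'
  have hxK : ∑ i, a₀ i • e₀ i ∈ K :=
    hK.isClosed.mem_of_tendsto hx (Eventually.of_forall fun n => hHK (φ n))
  -- In the limit x ≤ y ≤ x in the order of the closed cone, which is antisymmetric because the
  -- closure contains no line.
  have hxy : ∑ i, a₀' i • e₀' i = ∑ i, a₀ i • e₀ i := by
    have h1 : ∑ i, a₀' i • e₀' i - ∑ i, a₀ i • e₀ i ∈ closure C :=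
      isClosed_closure.mem_of_tendsto (hy.sub hx) (Eventually.of_forall fun n => (H (φ n)).le)
    have h2 : ∑ i, a₀ i • e₀ i - ∑ i, a₀' i • e₀' i ∈ closure C := by
      have ht : Tendsto (fun n => 1 + 1 / ((φ n : ℝ) + 1)) atTop (𝓝 (1 + 0)) :=
        (tendsto_one_div_add_atTop_nhds_zero_nat.comp hφ.tendsto_atTop).const_add 1
      have := (ht.smul hx).sub hy
      rw [add_zero, one_smul] at this
      exact isClosed_closure.mem_of_tendsto this (Eventually.of_forall fun n => (H (φ n)).ge)
    by_contra hne
    exact hC.neg_notMem_closure h1 (sub_ne_zero.2 hne) (by rwa [neg_sub])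
  have ha0 : ∀ i, 0 ≤ a₀ i := fun i =>
    ge_of_tendsto' (tendsto_pi_nhds.1 ha₀ i) fun n => (H (φ n)).nonneg i
  have ha0' : ∀ i, 0 ≤ a₀' i := fun i =>
    ge_of_tendsto' (tendsto_pi_nhds.1 ha₀' i) fun n => (H (φ n)).nonneg' i
  have hflat : IsConeFlat C e₀ := IsConeFlat.of_tendsto hC (fun n => (H (φ n)).flat) he₀
    (hKC hxK)
  have hflat' : IsConeFlat C e₀' := IsConeFlat.of_tendsto hC (fun n => (H (φ n)).flat') he₀'
    (hxy ▸ hKC hxK)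
  have hspan := hflat.span_eq_of_sum_eq hflat' hC hcc hsplit hd hd3
    (hflat.pos_of_sum_mem ha0 (hKC hxK)) hxy.symm
  have happ : ∀ j {u : ℕ → E} {u₀ : E}, Tendsto u atTop (𝓝 u₀) →
      Tendsto (fun n => h (φ n) j (u n)) atTop (𝓝 (h₀ j u₀)) := fun j u u₀ hu =>
    (isBoundedBilinearMap_apply.continuous.tendsto (_, _)).comp
      ((tendsto_pi_nhds.1 hh₀ j).prodMk_nhds hu)
  have hz : ∀ j i, i ≠ j → h₀ j (e₀ i) = 0 := fun j i hij =>
    tendsto_nhds_unique (happ j (tendsto_pi_nhds.1 he₀ i))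
      (by simp [((H (φ _)).support j).2.2 i hij])
  have hv : ∀ j, h₀ j v₀ = 0 := fun j =>
    tendsto_nhds_unique (happ j hv₀) (by simp [(H (φ _)).apply_eq_zero j])
  -- Only the weak inequality survives the limit; together with `hh0` it still gives positivity on
  -- the open cone.
  have hnn : ∀ j, ∀ x ∈ C, 0 ≤ h₀ j x := fun j x hx =>
    ge_of_tendsto' (happ j tendsto_const_nhds) fun n => ((H (φ n)).support j).1 x hx
  have hh0 : ∀ j, h₀ j ≠ 0 := fun j h0 => by
    have := tendsto_nhds_unique (tendsto_pi_nhds.1 hh₀ j).norm (b := 1) (by simp [hnh])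
    simp [h0] at this
  have hv0 : v₀ ≠ 0 := fun h0 => by
    have := tendsto_nhds_unique hv₀.norm (b := 1) (by simp [hnv])
    simp [h0] at this
  -- The limit direction is transverse to the first flat because all the `h₀ j` vanish on it, hence
  -- to the second, which has the same span.
  have hvspan : v₀ ∉ Submodule.span ℝ (Set.range e₀') := fun hmem => by
    rw [← hspan] at hmem
    exact hv0 (IsConeFlat.eq_zero_of_mem_span hz
      (fun j => hflat.pos_apply hC (hnn j) (hh0 j) (hz j)) hv hmem)
  obtain ⟨n, hn⟩ := (eventually_meetsSimplex hd hx hv₀ he₀' hflat'.linearIndependent hvspan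
    (hflat'.pos_of_sum_mem ha0' (hxy ▸ hKC hxK)) hxy.symm).exists
  exact hbad (φ n) hn

/-- Flats which come close to each other are crossed by the same normal lines. -/
theorem exists_eps_meetsSimplex (hC : IsSharpCone C) (hcc : IsCocompactCone C)
    (hsplit : ¬ Splits C) (hd : Module.finrank ℝ E = d + 1) (hd3 : 3 ≤ d) :
    ∃ ε : ℝ, 0 < ε ∧ ∀ e e' a a' h v, NearbyFlats C ε (d := d) e e' a a' h v →
      MeetsSimplex (∑ i, a i • e i) v e' := by
  obtain ⟨K, hKC, hK, hgK⟩ := id hcc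
  obtain ⟨ε, hε, hmain⟩ := exists_eps_of_isCompact hC hcc hsplit hd hd3 hKC hK
  refine ⟨ε, hε, fun e e' a a' h v H => ?_⟩
  -- Hypotheses and conclusion are invariant under automorphisms of `C`, so the marked point may be
  -- assumed to lie in `K`.
  obtain ⟨g, hg, hgx⟩ := hgK _ H.mem
  apply MeetsSimplex.of_map g
  have H1 := H.map g hg
  have H2 := H1.normalize hC
  have hunit : ∀ {F : Type _} [NormedAddCommGroup F] [NormedSpace ℝ F] {u : F}, u ≠ 0 →
      ‖‖u‖⁻¹ • u‖ = 1 := fun hu => by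
    rw [norm_smul, norm_inv, norm_norm, inv_mul_cancel₀ (norm_ne_zero_iff.2 hu)]
  have hsum : ∑ i, (‖g (e i)‖ * a i) • ‖g (e i)‖⁻¹ • g (e i) = g (∑ i, a i • e i) := by
    rw [map_sum]
    refine Finset.sum_congr rfl fun i _ => ?_
    have := norm_ne_zero_iff.2 (H1.flat.linearIndependent.ne_zero i)
    rw [smul_smul, map_smul]
    congr 1
    field_simp
  have := hmain _ _ _ _ _ _ H2 (by rw [hsum]; exact hgx)
    (fun i => hunit (H1.flat.linearIndependent.ne_zero i))
    (fun i => hunit (H1.flat'.linearIndependent.ne_zero i))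
    (fun j => hunit (H1.support j).2.1) (hunit H1.ne_zero)
  rw [hsum] at this
  exact this.of_smul fun i =>
    inv_pos.2 (norm_pos_iff.2 (H1.flat'.linearIndependent.ne_zero i))

end NearbyFlats

/-! ### From projective domains to cones -/

section Projective

variable {d : ℕ}

lemma mem_preimage_iff {S : Set (RP d)} {v : Fin (d + 1) → ℝ} (hv : v ≠ 0) :
    v ∈ preimage S ↔ Projectivization.mk ℝ v hv ∈ S := by
  constructor
  · rintro ⟨p, hp, h, rfl⟩
    exact hp
  · exact fun h => ⟨_, h, hv, rfl⟩

lemma ne_zero_of_mem_preimage {S : Set (RP d)} {v : Fin (d + 1) → ℝ} (hv : v ∈ preimage S) :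
    v ≠ 0 := by
  obtain ⟨p, -, h, -⟩ := hv
  exact h

lemma mk_smul {v : Fin (d + 1) → ℝ} (hv : v ≠ 0) {c : ℝ} (hc : c ≠ 0) :
    Projectivization.mk ℝ (c • v) (smul_ne_zero hc hv) = Projectivization.mk ℝ v hv :=
  (Projectivization.mk_eq_mk_iff' ℝ _ _ _ _).2 ⟨c, rfl⟩

lemma smul_mem_preimage {S : Set (RP d)} {v : Fin (d + 1) → ℝ} {c : ℝ} (hc : c ≠ 0)
    (hv : v ∈ preimage S) : c • v ∈ preimage S := by
  have h := ne_zero_of_mem_preimage hv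
  rwa [mem_preimage_iff (smul_ne_zero hc h), mk_smul h hc, ← mem_preimage_iff]

lemma neg_mem_preimage {S : Set (RP d)} {v : Fin (d + 1) → ℝ} (hv : v ∈ preimage S) :
    -v ∈ preimage S := by
  simpa using smul_mem_preimage (c := -1) (by norm_num) hv

lemma isOpen_iff_isOpen_preimage {S : Set (RP d)} : IsOpen S ↔ IsOpen (preimage S) := by
  have hq : Topology.IsQuotientMap
      (Projectivization.mk' ℝ : {v : Fin (d + 1) → ℝ // v ≠ 0} → RP d) := isQuotientMap_quot_mk
  have he : preimage S = Subtype.val ''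
      ((Projectivization.mk' ℝ : {v : Fin (d + 1) → ℝ // v ≠ 0} → RP d) ⁻¹' S) := by
    ext v
    constructor
    · intro hv
      have h := ne_zero_of_mem_preimage hv
      exact ⟨⟨v, h⟩, (mem_preimage_iff h).1 hv, rfl⟩
    · rintro ⟨⟨v, h⟩, hv, rfl⟩
      exact (mem_preimage_iff h).2 hv
  have hemb : Topology.IsOpenEmbedding (Subtype.val : {v : Fin (d + 1) → ℝ // v ≠ 0} → _) :=
    isOpen_ne.isOpenEmbedding_subtypeVal
  rw [← hq.isOpen_preimage, he, hemb.isOpen_iff_image_isOpen]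

lemma mem_preimage_compl_iff {S : Set (RP d)} {v : Fin (d + 1) → ℝ} (hv : v ≠ 0) :
    v ∈ preimage Sᶜ ↔ v ∉ preimage S := by
  rw [mem_preimage_iff hv, mem_preimage_iff hv, Set.mem_compl_iff]

lemma mem_preimage_closure {S : Set (RP d)} {v : Fin (d + 1) → ℝ} (hv : v ≠ 0)
    (h : v ∈ closure (preimage S)) : v ∈ preimage (closure S) := by
  by_contra hc
  have hopen : IsOpen (preimage (closure S)ᶜ) :=
    isOpen_iff_isOpen_preimage.1 isClosed_closure.isOpen_compl
  obtain ⟨w, hw, hwS⟩ := mem_closure_iff.1 h _ hopen ((mem_preimage_compl_iff hv).2 hc)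
  have hw0 := ne_zero_of_mem_preimage hwS
  rw [mem_preimage_iff hw0] at hw hwS
  exact hw (subset_closure hwS)

/-- The component on which `η` is positive of the preimage of a properly convex domain. -/
def coneOver (Ω : Set (RP d)) (η : Module.Dual ℝ (Fin (d + 1) → ℝ)) : Set (Fin (d + 1) → ℝ) :=
  {v | 0 < η v ∧ v ∈ preimage Ω}

/-- `η` defines an affine chart which witnesses that `Ω` is properly convex. -/
structure IsConvexChart (Ω : Set (RP d)) (η : Module.Dual ℝ (Fin (d + 1) → ℝ)) : Prop where
  isOpen : IsOpen Ω
  ne_zero : ∀ v ∈ preimage (closure Ω), η v ≠ 0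
  convex : Convex ℝ {v | η v = 1 ∧ v ∈ preimage Ω}

namespace IsConvexChart

variable {Ω : Set (RP d)} {η : Module.Dual ℝ (Fin (d + 1) → ℝ)} (hη : IsConvexChart Ω η)
include hη

lemma ne_zero_of_mem {v : Fin (d + 1) → ℝ} (hv : v ∈ preimage Ω) : η v ≠ 0 := by
  refine hη.ne_zero v ?_
  obtain ⟨p, hp, h⟩ := hv
  exact ⟨p, subset_closure hp, h⟩

lemma mem_or_neg_mem {v : Fin (d + 1) → ℝ} (hv : v ∈ preimage Ω) :
    v ∈ coneOver Ω η ∨ -v ∈ coneOver Ω η := by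
  rcases (hη.ne_zero_of_mem hv).lt_or_gt with h | h
  · exact Or.inr ⟨by simpa using h, neg_mem_preimage hv⟩
  · exact Or.inl ⟨h, hv⟩

lemma isSharpCone (hne : Ω.Nonempty) : IsSharpCone (coneOver Ω η) where
  isOpen := by
    have hc : Continuous η := η.continuous_of_finiteDimensional
    exact (isOpen_lt continuous_const hc).inter (isOpen_iff_isOpen_preimage.1 hη.isOpen)
  nonempty := by
    obtain ⟨p, hp⟩ := hne
    rcases hη.mem_or_neg_mem (v := p.rep)
      ((mem_preimage_iff p.rep_nonzero).2 (by rwa [p.mk_rep])) with h | h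
    · exact ⟨_, h⟩
    · exact ⟨_, h⟩
  zero_notMem h := by simpa using h.1
  add_mem := by
    rintro x y ⟨hx, hx'⟩ ⟨hy, hy'⟩
    refine ⟨by rw [map_add]; positivity, ?_⟩
    -- Both points are scaled to the slice η = 1, where convexity is known; the weights are those
    -- that give a multiple of x + y.
    have h := hη.convex (x := (η x)⁻¹ • x) ⟨by simp [hx.ne'], smul_mem_preimage (by positivity) hx'⟩
      (y := (η y)⁻¹ • y) ⟨by simp [hy.ne'], smul_mem_preimage (by positivity) hy'⟩
      (a := η x / (η x + η y)) (b := η y / (η x + η y)) (by positivity) (by positivity)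
      (by field_simp)
    have h2 := smul_mem_preimage (c := η x + η y) (by positivity) h.2
    convert h2 using 1
    rw [smul_add, smul_smul, smul_smul, smul_smul, smul_smul]
    have h3 : (η x + η y) * (η x / (η x + η y) * (η x)⁻¹) = 1 := by field_simp
    have h4 : (η x + η y) * (η y / (η x + η y) * (η y)⁻¹) = 1 := by field_simp
    simp only [← mul_assoc] at h3 h4 ⊢
    rw [h3, h4, one_smul, one_smul]
  smul_mem := by
    rintro c x hc ⟨hx, hx'⟩
    exact ⟨by rw [map_smul]; exact mul_pos hc hx, smul_mem_preimage hc.ne' hx'⟩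
  exists_pos := by
    refine ⟨LinearMap.toContinuousLinearMap η, fun x hx hx0 => ?_⟩
    have hc : Continuous η := η.continuous_of_finiteDimensional
    have h1 : 0 ≤ η x := closure_minimal (t := {x | 0 ≤ η x}) (fun v hv => hv.1.le)
      (isClosed_le continuous_const hc) hx
    have h2 : η x ≠ 0 := hη.ne_zero x (mem_preimage_closure hx0
      (closure_mono (fun v hv => hv.2) hx))
    exact h1.lt_of_ne h2.symm

lemma connectedComponentIn_eq (hne : Ω.Nonempty) {v₀ : Fin (d + 1) → ℝ}
    (hv₀ : v₀ ∈ coneOver Ω η) : connectedComponentIn (preimage Ω) v₀ = coneOver Ω η := by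
  have hC := hη.isSharpCone hne
  apply Set.Subset.antisymm
  -- `C` and -`C` are disjoint open sets covering the preimage of Ω.
  · refine isPreconnected_connectedComponentIn.subset_left_of_subset_union
      (v := -coneOver Ω η) hC.isOpen hC.isOpen.neg ?_ ?_ ?_
    · rw [Set.disjoint_left]
      intro v hv hv'
      have h1 := hv.1
      have h2 := hv'.1
      rw [map_neg] at h2
      linarith
    · exact (connectedComponentIn_subset _ _).trans fun v hv => hη.mem_or_neg_mem hv
    · exact ⟨v₀, mem_connectedComponentIn hv₀.2, hv₀⟩
  · exact hC.convex.isPreconnected.subset_connectedComponentIn hv₀ fun v hv => hv.2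

lemma isReducible_of_splits (hne : Ω.Nonempty) (h : Splits (coneOver Ω η)) : IsReducible Ω := by
  have hC := hη.isSharpCone hne
  obtain ⟨v₀, hv₀⟩ := hC.nonempty
  obtain ⟨P, hPP, hP0, hP1, hP⟩ := h
  let K : ConvexCone ℝ (Fin (d + 1) → ℝ) :=
    { carrier := coneOver Ω η
      smul_mem' := fun _ hc _ hx => hC.smul_mem hc hx
      add_mem' := fun _ hx _ hy => hC.add_mem hx hy }
  refine ⟨v₀, hv₀.2, LinearMap.range P, LinearMap.ker P, fun h => hP1 ?_, fun h => hP0 ?_,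
    IsCompl.of_eq ?_ ?_, K.map P, K.map (LinearMap.id - P), ?_, ?_, ?_⟩
  · refine LinearMap.ext fun x => ?_
    obtain ⟨y, rfl⟩ := LinearMap.range_eq_top.1 h x
    exact hPP y
  · exact LinearMap.ker_eq_top.1 h
  · rw [Submodule.eq_bot_iff]
    rintro _ ⟨⟨y, rfl⟩, hy⟩
    rw [← hPP]
    exact hy
  · rw [Submodule.eq_top_iff']
    intro x
    have : x = P x + (x - P x) := by abel
    rw [this]
    exact Submodule.add_mem_sup ⟨x, rfl⟩ (by simp [hPP])
  · rintro _ ⟨x, -, rfl⟩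
    exact ⟨x, rfl⟩
  · rintro _ ⟨x, -, rfl⟩
    change P (x - P x) = 0
    simp [hPP]
  · rw [hη.connectedComponentIn_eq hne hv₀]
    ext x
    rw [Set.mem_add]
    constructor
    · intro hx
      exact ⟨P x, ⟨x, hx, rfl⟩, x - P x, ⟨x, hx, rfl⟩, by abel⟩
    · rintro ⟨_, ⟨y, hy, rfl⟩, _, ⟨z, hz, rfl⟩, rfl⟩
      exact hP y hy z hz

/-- If G sent x into the cone and z into its negative, a positive combination of x and z would be
mapped into ker η, which misses the preimage of Ω. -/
lemma map_mem_coneOver (hne : Ω.Nonempty) {G : (Fin (d + 1) → ℝ) ≃L[ℝ] (Fin (d + 1) → ℝ)}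
    (hG : ∀ z, z ∈ preimage Ω → G z ∈ preimage Ω) {x : Fin (d + 1) → ℝ} (hx : x ∈ coneOver Ω η)
    (hGx : G x ∈ coneOver Ω η) {z : Fin (d + 1) → ℝ} (hz : z ∈ coneOver Ω η) :
    G z ∈ coneOver Ω η := by
  have hC := hη.isSharpCone hne
  rcases hη.mem_or_neg_mem (hG z hz.2) with h | h
  · exact h
  exfalso
  have h1 : 0 < -η (G z) := by simpa using h.1
  have h2 := hC.add_mem (hC.smul_mem hGx.1 hz) (hC.smul_mem h1 hx)
  refine hη.ne_zero_of_mem (hG _ h2.2) ?_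
  simp only [map_add, map_smul, smul_eq_mul]
  ring

lemma exists_automorphism (hne : Ω.Nonempty) {g : ProjGL d} (hg : g ∈ Aut Ω)
    {x y : Fin (d + 1) → ℝ} (hx : x ∈ coneOver Ω η) (hy : y ∈ coneOver Ω η) {hx0 : x ≠ 0}
    {hy0 : y ≠ 0} (hxy : g • Projectivization.mk ℝ x hx0 = Projectivization.mk ℝ y hy0) :
    ∃ G : (Fin (d + 1) → ℝ) ≃L[ℝ] (Fin (d + 1) → ℝ),
      (∀ z, G z ∈ coneOver Ω η ↔ z ∈ coneOver Ω η) ∧ G x = y := by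
  induction g using Matrix.ProjGenLinGroup.induction_on with | mk A => ?_
  rw [Projectivization.PGL.mk_smul_mk, Projectivization.mk_eq_mk_iff'] at hxy
  obtain ⟨c, hc⟩ := hxy
  have hc0 : c ≠ 0 := by
    rintro rfl
    rw [zero_smul] at hc
    exact (smul_ne_zero_iff_ne A).2 hx0 hc.symm
  -- The scalar, possibly negative, is chosen so that G x is exactly y; this also selects the
  -- correct component.
  let G : (Fin (d + 1) → ℝ) ≃L[ℝ] (Fin (d + 1) → ℝ) :=
    ((DistribMulAction.toLinearEquiv ℝ (Fin (d + 1) → ℝ) A).trans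
      (LinearEquiv.smulOfNeZero ℝ _ c⁻¹ (inv_ne_zero hc0))).toContinuousLinearEquiv
  have hGapp : ∀ z, G z = c⁻¹ • A • z := fun z => rfl
  have hGx : G x = y := by
    rw [hGapp, ← hc, inv_smul_smul₀ hc0]
  have hGpre : ∀ z, G z ∈ preimage Ω ↔ z ∈ preimage Ω := by
    intro z
    by_cases hz : z = 0
    · subst hz
      simp
    have hAz := (smul_ne_zero_iff_ne A).2 hz
    rw [hGapp, mem_preimage_iff (smul_ne_zero (inv_ne_zero hc0) hAz), mk_smul hAz (inv_ne_zero hc0),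
      mem_preimage_iff hz, ← Projectivization.PGL.mk_smul_mk]
    have h1 : Matrix.ProjGenLinGroup.mk A • Ω = Ω := hg
    conv_lhs => rw [← h1]
    exact Set.smul_mem_smul_set_iff
  refine ⟨G, fun z => ⟨fun hz => ?_, fun hz => ?_⟩, hGx⟩
  · have := hη.map_mem_coneOver hne (G := G.symm) (fun w hw => by
      rw [← hGpre]; simpa using hw) hy (by rw [← hGx]; simpa using hx) hz
    simpa using this
  · exact hη.map_mem_coneOver hne (fun w hw => (hGpre w).2 hw) hx (by rwa [hGx]) hz

lemma isCocompactCone (hne : Ω.Nonempty) (hdiv : IsDivisible Ω) :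
    IsCocompactCone (coneOver Ω η) := by
  have hC := hη.isSharpCone hne
  obtain ⟨Γ, hΓ, -, hcomp⟩ := hdiv
  set C := coneOver Ω η
  have hC0 : ∀ x : C, (x : Fin (d + 1) → ℝ) ≠ 0 := fun x => hC.ne_zero x.2
  let q : C → Ω := fun x => ⟨Projectivization.mk ℝ x (hC0 x), (mem_preimage_iff _).1 x.2.2⟩
  let π : C → Quotient (orbitSetoid Γ Ω) := fun x => Quotient.mk _ (q x)
  have hsurj : Function.Surjective π := by
    intro p
    induction p using Quotient.inductionOn with | h p => ?_
    obtain ⟨p, hp⟩ := p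
    have hrep : p.rep ∈ preimage Ω := (mem_preimage_iff p.rep_nonzero).2 (by rwa [p.mk_rep])
    rcases hη.mem_or_neg_mem hrep with h | h
    · refine ⟨⟨_, h⟩, congrArg (Quotient.mk (orbitSetoid Γ Ω)) (Subtype.ext ?_)⟩
      exact p.mk_rep
    · refine ⟨⟨_, h⟩, congrArg (Quotient.mk (orbitSetoid Γ Ω)) (Subtype.ext ?_)⟩
      have h1 := mk_smul p.rep_nonzero (c := -1) (by norm_num)
      simp only [neg_smul, one_smul, p.mk_rep] at h1
      exact h1
  have hopen : IsOpenMap π := by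
    intro U hU
    rw [← isQuotientMap_quotient_mk'.isOpen_preimage]
    set S : Set (RP d) := {p | ∃ g ∈ Γ, ∃ u ∈ U, g • p = q u} with hS
    have hpre : Quotient.mk (orbitSetoid Γ Ω) ⁻¹' (π '' U) = Subtype.val ⁻¹' S := by
      ext p
      constructor
      · rintro ⟨u, hu, hup⟩
        obtain ⟨g, hg, h⟩ := Quotient.exact hup.symm
        exact ⟨g, hg, u, hu, h⟩
      · rintro ⟨g, hg, u, hu, h⟩
        exact ⟨u, hu, Quotient.sound ((orbitSetoid Γ Ω).symm ⟨g, hg, h⟩)⟩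
    change IsOpen (Quotient.mk (orbitSetoid Γ Ω) ⁻¹' (π '' U))
    rw [hpre]
    refine IsOpen.preimage continuous_subtype_val (isOpen_iff_isOpen_preimage.2 ?_)
    have hU' : IsOpen (Subtype.val '' U) := hC.isOpen.isOpenMap_subtype_val U hU
    -- The preimage is a union of inverse images of the open set `U` under the maps v ↦ c A v.
    have hSpre : preimage S = ⋃ (A : GL (Fin (d + 1)) ℝ) (_ : Matrix.ProjGenLinGroup.mk A ∈ Γ)
        (c : ℝ) (_ : c ≠ 0), {v | c • A • v ∈ Subtype.val '' U} := by
      ext v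
      simp only [Set.mem_iUnion, Set.mem_ofPred_eq]
      constructor
      · intro hv
        have hv0 := ne_zero_of_mem_preimage hv
        obtain ⟨g, hg, u, hu, h⟩ := (mem_preimage_iff hv0).1 hv
        induction g using Matrix.ProjGenLinGroup.induction_on with | mk A => ?_
        obtain ⟨c, hc⟩ := (Projectivization.mk_eq_mk_iff' ℝ _ _ _ _).1 h.symm
        refine ⟨A, hg, c, ?_, u, hu, hc.symm⟩
        rintro rfl
        rw [zero_smul] at hc
        exact hC0 u hc.symm
      · rintro ⟨A, hA, c, hc, u, hu, h⟩
        have hv0 : v ≠ 0 := by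
          rintro rfl
          rw [smul_zero, smul_zero] at h
          exact hC0 u h
        refine (mem_preimage_iff hv0).2 ⟨_, hA, u, hu, ?_⟩
        rw [Projectivization.PGL.mk_smul_mk]
        exact (Projectivization.mk_eq_mk_iff' ℝ _ _ _ _).2
          ⟨c⁻¹, by rw [h, inv_smul_smul₀ hc]⟩
    rw [hSpre]
    refine isOpen_iUnion fun A => isOpen_iUnion fun _ => isOpen_iUnion fun c =>
      isOpen_iUnion fun _ => hU'.preimage ?_
    have : Continuous (DistribMulAction.toLinearEquiv ℝ (Fin (d + 1) → ℝ) A).toLinearMap :=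
      LinearMap.continuous_of_finiteDimensional _
    exact this.const_smul c
  have : LocallyCompactSpace C := hC.isOpen.locallyCompactSpace
  -- Any exhaustion serves. The interiors have open images increasing to the compact quotient, so a
  -- single member already covers it.
  let K : CompactExhaustion C := default
  obtain ⟨n, hn⟩ := isCompact_univ.elim_directed_cover (fun n => π '' interior (K n))
    (fun n => hopen _ isOpen_interior) (fun p _ => by
      obtain ⟨x, rfl⟩ := hsurj p
      obtain ⟨n, hn⟩ := K.exists_mem x
      exact Set.mem_iUnion.2 ⟨n + 1, x, K.subset_interior_succ n hn, rfl⟩)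
    (Monotone.directed_le fun m n hmn =>
      Set.image_mono (interior_mono (K.subset hmn)))
  refine ⟨Subtype.val '' (K n), ?_, (K.isCompact n).image continuous_subtype_val, fun x hx => ?_⟩
  · rintro _ ⟨x, -, rfl⟩
    exact x.2
  · obtain ⟨k, hk, hkx⟩ := hn (Set.mem_univ (π ⟨x, hx⟩))
    obtain ⟨g, hg, h⟩ := Quotient.exact hkx.symm
    obtain ⟨G, hG, hGx⟩ := hη.exists_automorphism hne (hΓ hg) hx k.2 h
    exact ⟨G, hG, k, interior_subset hk, hGx.symm⟩

end IsConvexChart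

end Projective

/-! ### The Hilbert distance and the order of the cone -/

section HilbertDistance

variable {d : ℕ}

lemma Represents.exists_smul_eq {v x : Fin (d + 1) → ℝ} {hx : x ≠ 0}
    (h : Represents v (Projectivization.mk ℝ x hx)) : ∃ c : ℝ, c ≠ 0 ∧ v = c • x := by
  obtain ⟨hv, h⟩ := h
  obtain ⟨c, hc⟩ := (Projectivization.mk_eq_mk_iff' ℝ _ _ _ _).1 h
  refine ⟨c, ?_, hc.symm⟩
  rintro rfl
  rw [zero_smul] at hc
  exact hv hc.symm

lemma represents_smul {v : Fin (d + 1) → ℝ} (hv : v ≠ 0) {c : ℝ} (hc : c ≠ 0) :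
    Represents (c • v) (Projectivization.mk ℝ v hv) :=
  ⟨smul_ne_zero hc hv, mk_smul hv hc⟩

/-- A closed cone has closed image in projective space. -/
lemma isClosed_setOf_represents {Q : Set (Fin (d + 1) → ℝ)} (hQ : IsClosed Q)
    (hsmul : ∀ c : ℝ, 0 < c → ∀ v ∈ Q, c • v ∈ Q) :
    IsClosed {p : RP d | ∃ v ∈ Q, Represents v p} := by
  rw [← isOpen_compl_iff, isOpen_iff_isOpen_preimage]
  have : preimage {p : RP d | ∃ v ∈ Q, Represents v p}ᶜ = {0}ᶜ ∩ (Qᶜ ∩ (-Q)ᶜ) := by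
    ext v
    by_cases hv : v = 0
    · subst hv
      simp only [Set.mem_inter_iff, Set.mem_compl_iff, Set.mem_singleton_iff, not_true_eq_false,
        false_and, iff_false]
      exact fun h => ne_zero_of_mem_preimage h rfl
    rw [mem_preimage_compl_iff hv, mem_preimage_iff hv]
    simp only [Set.mem_inter_iff, Set.mem_compl_iff, Set.mem_singleton_iff, hv, not_false_eq_true,
      true_and, ← not_or, not_iff_not]
    constructor
    · rintro ⟨w, hw, hwv⟩
      obtain ⟨c, hc, rfl⟩ := hwv.exists_smul_eq
      rcases hc.lt_or_gt with h | h
      · right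
        have := hsmul (-c)⁻¹ (inv_pos.2 (neg_pos.2 h)) _ hw
        rw [smul_smul, inv_neg, neg_mul, inv_mul_cancel₀ hc] at this
        simpa using this
      · left
        have := hsmul c⁻¹ (inv_pos.2 h) _ hw
        rwa [smul_smul, inv_mul_cancel₀ hc, one_smul] at this
    · rintro (h | h)
      · exact ⟨v, h, hv, rfl⟩
      · refine ⟨-v, h, ?_⟩
        have := represents_smul hv (c := -1) (by norm_num)
        simpa using this
  rw [this]
  exact isOpen_compl_singleton.inter (hQ.isOpen_compl.inter hQ.neg.isOpen_compl)

/-- α is the largest t with x - ty in the closure; such t are bounded because a functional positive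
on the closure must stay nonnegative. -/
lemma IsSharpCone.exists_sub_smul_mem_boundary {E : Type*} [NormedAddCommGroup E]
    [NormedSpace ℝ E] {C : Set E} (hC : IsSharpCone C) {x y : E} (hx : x ∈ C) (hy : y ∈ C) :
    ∃ α : ℝ, 0 < α ∧ x - α • y ∈ closure C ∧ x - α • y ∉ C := by
  obtain ⟨η, hη⟩ := hC.exists_pos
  have hηy := hη y (subset_closure hy) (hC.ne_zero hy)
  have hnn : ∀ z ∈ closure C, 0 ≤ η z := fun z hz => by
    by_cases h : z = 0
    · simp [h]
    · exact (hη z hz h).le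
  have hcont : Continuous fun t : ℝ => x - t • y := by fun_prop
  have hcomp : IsCompact (Set.Icc 0 (η x / η y) ∩ (fun t : ℝ => x - t • y) ⁻¹' closure C) :=
    isCompact_Icc.inter_right (isClosed_closure.preimage hcont)
  have hmem : ∀ t : ℝ, 0 ≤ t → x - t • y ∈ closure C →
      t ∈ Set.Icc 0 (η x / η y) ∩ (fun t : ℝ => x - t • y) ⁻¹' closure C := fun t ht h => by
    refine ⟨⟨ht, ?_⟩, h⟩
    have := hnn _ h
    rw [map_sub, map_smul, smul_eq_mul, sub_nonneg] at this
    rwa [le_div_iff₀ hηy]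
  obtain ⟨α, hα, hmax⟩ := hcomp.exists_isGreatest
    ⟨0, hmem 0 le_rfl (by simpa using subset_closure hx)⟩
  refine ⟨α, ?_, hα.2, fun h => ?_⟩
  · obtain ⟨ε, hε, h⟩ := hC.exists_sub_smul_mem hx y
    exact hε.trans_le (hmax (hmem ε hε.le (subset_closure (h ε (by rw [abs_of_pos hε])))))
  · obtain ⟨ε, hε, h'⟩ := hC.exists_sub_smul_mem h y
    have h1 := h' ε (by rw [abs_of_pos hε])
    rw [sub_sub, ← add_smul] at h1
    have := hmax (hmem (α + ε) (by linarith [hα.1.1]) (subset_closure h1))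
    linarith

/-- The order relations between two points of a cone implied by a bound on the cross ratio. -/
lemma IsSharpCone.le_of_crossRatio {E : Type*} [NormedAddCommGroup E]
    [NormedSpace ℝ E] {C : Set E} (hC : IsSharpCone C) {x y u w : E} (hx : x ∈ C) (hy : y ∈ C)
    (hu : u ∈ closure C) (huC : u ∉ C) (hw : w ∈ closure C) (hwC : w ∉ C) {s t l m : ℝ}
    (hs : s ≠ 0) (hl : l ≠ 0) (hm : m ≠ 0) (hxs : u + s • w = l • x) (hyt : u + t • w = m • y)
    (hc : 1 ≤ t / s) : ∃ r : ℝ, 0 < r ∧ r • y - x ∈ closure C ∧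
      (t / s) • x - r • y ∈ closure C := by
  -- For s < 0, solving u + sw = lx for w or for u, according to the sign of l, would put a boundary
  -- point into `C`.
  have hs0 : 0 < s := by
    by_contra! hneg
    replace hneg : s < 0 := lt_of_le_of_ne hneg hs
    rcases hl.lt_or_gt with h | h
    · apply hwC
      have h1 : w = (-s)⁻¹ • (u + (-l) • x) := by
        rw [eq_inv_smul_iff₀ (neg_ne_zero.2 hs), neg_smul, neg_smul, ← hxs]
        abel
      rw [h1]
      exact hC.smul_mem (inv_pos.2 (neg_pos.2 hneg))
        (hC.closure_add_mem hu (hC.smul_mem (neg_pos.2 h) hx))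
    · apply huC
      have h1 : u = (-s) • w + l • x := by
        rw [← hxs, neg_smul]
        abel
      rw [h1]
      exact hC.closure_add_mem (hC.closure_smul (by linarith) hw) (hC.smul_mem h hx)
  have ht0 : 0 < t := by
    have := (le_div_iff₀ hs0).1 hc
    linarith
  have hpos : ∀ {z : E} {k a : ℝ}, z ∈ C → k ≠ 0 → 0 < a → u + a • w = k • z → 0 < k := by
    intro z k a hz hk ha h
    by_contra! hneg
    replace hneg : k < 0 := lt_of_le_of_ne hneg hk
    have h1 : -((-k) • z) ∈ closure C := by
      rw [neg_smul, neg_neg, ← h]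
      exact hC.closure_add hu (hC.closure_smul ha.le hw)
    have h2 := hC.smul_mem (neg_pos.2 hneg) hz
    exact hC.neg_notMem_closure (subset_closure h2) (hC.ne_zero h2) h1
  have hl0 := hpos hx hl hs0 hxs
  have hm0 := hpos hy hm ht0 hyt
  -- With this scaling of y both differences are nonnegative multiples of boundary vectors: of `w`
  -- for the first and of `u` for the second.
  refine ⟨m / l, div_pos hm0 hl0, ?_, ?_⟩
  · have h1 : (m / l) • y - x = ((t - s) / l) • w := by
      have h2 : (m / l) • y = l⁻¹ • (m • y) := by rw [smul_smul, inv_mul_eq_div]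
      have h3 : x = l⁻¹ • (l • x) := by rw [inv_smul_smul₀ hl]
      rw [h2]
      conv_lhs => rw [h3]
      rw [← hyt, ← hxs]
      module
    rw [h1]
    refine hC.closure_smul (div_nonneg ?_ hl0.le) hw
    rw [le_div_iff₀ hs0] at hc
    linarith
  · have h1 : (t / s) • x - (m / l) • y = ((t / s - 1) / l) • u := by
      have h2 : (m / l) • y = l⁻¹ • (m • y) := by rw [smul_smul, inv_mul_eq_div]
      have h3 : x = l⁻¹ • (l • x) := by rw [inv_smul_smul₀ hl]
      rw [h2]
      conv_lhs => rw [h3]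
      rw [← hyt, ← hxs]
      have h4 : (t / s) • l⁻¹ • (u + s • w) = (t / s * l⁻¹) • u + (t * l⁻¹) • w := by
        rw [smul_smul, smul_add, smul_smul]
        congr 2
        field_simp
      rw [h4]
      module
    rw [h1]
    exact hC.closure_smul (div_nonneg (by linarith) hl0.le) hu

namespace IsConvexChart

variable {Ω : Set (RP d)} {η : Module.Dual ℝ (Fin (d + 1) → ℝ)} (hη : IsConvexChart Ω η)
include hη

lemma mem_preimage_iff_coneOver {v : Fin (d + 1) → ℝ} :
    v ∈ preimage Ω ↔ v ∈ coneOver Ω η ∨ -v ∈ coneOver Ω η := by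
  refine ⟨hη.mem_or_neg_mem, ?_⟩
  rintro (h | h)
  · exact h.2
  · simpa using neg_mem_preimage h.2

lemma mk_mem_frontier_iff (hne : Ω.Nonempty) {v : Fin (d + 1) → ℝ} (hv : v ≠ 0) :
    Projectivization.mk ℝ v hv ∈ frontier Ω ↔
      (v ∈ closure (coneOver Ω η) ∨ -v ∈ closure (coneOver Ω η)) ∧
        v ∉ coneOver Ω η ∧ -v ∉ coneOver Ω η := by
  have hC := hη.isSharpCone hne
  rw [frontier, hη.isOpen.interior_eq, Set.mem_sdiff, ← mem_preimage_iff (S := Ω) hv,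
    hη.mem_preimage_iff_coneOver, not_or]
  refine and_congr_left fun _ => ⟨fun h => ?_, fun h => ?_⟩
  · have hcl := isClosed_setOf_represents (d := d) (isClosed_closure (s := coneOver Ω η))
      (fun c hc v hv => hC.closure_smul_pos hc hv)
    obtain ⟨w, hw, hwv⟩ := closure_minimal (fun p hp => by
      have hrep : p.rep ∈ preimage Ω := (mem_preimage_iff p.rep_nonzero).2 (by rwa [p.mk_rep])
      have h1 := represents_smul p.rep_nonzero (c := -1) (by norm_num)
      rw [p.mk_rep, neg_smul, one_smul] at h1
      rcases hη.mem_or_neg_mem hrep with h | h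
      · exact ⟨_, subset_closure h, p.rep_nonzero, p.mk_rep⟩
      · exact ⟨_, subset_closure h, h1⟩) hcl h
    obtain ⟨c, hc, rfl⟩ := hwv.exists_smul_eq
    rcases hc.lt_or_gt with h | h
    · right
      have := hC.closure_smul_pos (inv_pos.2 (neg_pos.2 h)) hw
      rwa [smul_smul, inv_neg, neg_mul, inv_mul_cancel₀ hc, neg_smul, one_smul] at this
    · left
      have := hC.closure_smul_pos (inv_pos.2 h) hw
      rwa [smul_smul, inv_mul_cancel₀ hc, one_smul] at this
  · rcases h with h | h
    · exact (mem_preimage_iff hv).1 (mem_preimage_closure hv (closure_mono (fun v hv => hv.2) h))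
    · have := mem_preimage_closure (neg_ne_zero.2 hv) (closure_mono (fun v hv => hv.2) h)
      have := neg_mem_preimage this
      rw [neg_neg] at this
      exact (mem_preimage_iff hv).1 this

lemma exists_hasCrossRatio (hne : Ω.Nonempty) {x y : Fin (d + 1) → ℝ}
    (hx : x ∈ coneOver Ω η) (hy : y ∈ coneOver Ω η) (hxy : LinearIndependent ℝ ![x, y])
    {hx0 : x ≠ 0} {hy0 : y ≠ 0} : ∃ z₁ ∈ frontier Ω, ∃ z₂ ∈ frontier Ω, ∃ c : ℝ, 1 ≤ c ∧
      HasCrossRatio z₁ (Projectivization.mk ℝ x hx0) (Projectivization.mk ℝ y hy0) z₂ c ∧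
      HasCrossRatio z₁ (Projectivization.mk ℝ x hx0) (Projectivization.mk ℝ x hx0) z₂ 1 := by
  have hC := hη.isSharpCone hne
  rw [LinearIndependent.pair_iff] at hxy
  obtain ⟨α, hα, hα', hαC⟩ := hC.exists_sub_smul_mem_boundary hx hy
  obtain ⟨β, hβ, hβ', hβC⟩ := hC.exists_sub_smul_mem_boundary hy hx
  have hu0 : x - α • y ≠ 0 := fun h => by
    have := hxy 1 (-α) (by rw [one_smul, neg_smul, ← sub_eq_add_neg, h])
    exact one_ne_zero this.1
  have hw0 : y - β • x ≠ 0 := fun h => by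
    have := hxy (-β) 1 (by rw [one_smul, neg_smul, ← h]; abel)
    exact one_ne_zero this.2
  have hfr : ∀ {v : Fin (d + 1) → ℝ} (hv : v ≠ 0), v ∈ closure (coneOver Ω η) →
      v ∉ coneOver Ω η → Projectivization.mk ℝ v hv ∈ frontier Ω := fun hv h h' => by
    rw [hη.mk_mem_frontier_iff hne]
    exact ⟨Or.inl h, h', fun h2 => hC.zero_notMem (by simpa using hC.closure_add_mem h h2)⟩
  -- Otherwise u + αw = (1 - αβ)x, with u = x - αy and w = y - βx, would be zero or a negative
  -- multiple of x, which sharpness forbids.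
  have hαβ : α * β < 1 := by
    by_contra! hle
    have h1 : (1 - α * β) • x ∈ closure (coneOver Ω η) := by
      have := hC.closure_add hα' (hC.closure_smul hα.le hβ')
      convert this using 1
      module
    rcases hle.eq_or_lt with h | h
    · have h2 : -(x - α • y) ∈ closure (coneOver Ω η) := by
        have := hC.closure_smul hα.le hβ'
        rw [smul_sub, smul_smul, ← h, one_smul] at this
        rwa [neg_sub]
      exact hC.neg_notMem_closure hα' hu0 h2
    · have h2 : (α * β - 1) • x ∈ coneOver Ω η := hC.smul_mem (by linarith) hx
      refine hC.neg_notMem_closure (subset_closure h2) (hC.ne_zero h2) ?_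
      convert h1 using 1
      module
  have hli : LinearIndependent ℝ ![x - α • y, y - β • x] := by
    rw [LinearIndependent.pair_iff]
    intro s t hst
    obtain ⟨h1, h2⟩ := hxy (s - t * β) (t - s * α) (by rw [← hst]; module)
    have h3 : s * (1 - α * β) = 0 := by linear_combination h1 + β * h2
    have hs : s = 0 := (mul_eq_zero.1 h3).resolve_right (by linarith)
    refine ⟨hs, ?_⟩
    rw [hs] at h2
    linarith
  have hrx : Represents (x - α • y + α • (y - β • x)) (Projectivization.mk ℝ x hx0) := by
    have := represents_smul hx0 (c := 1 - α * β) (by linarith)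
    convert this using 1
    module
  have hry : Represents (x - α • y + β⁻¹ • (y - β • x)) (Projectivization.mk ℝ y hy0) := by
    have := represents_smul hy0 (c := β⁻¹ - α) (by
      have : α < β⁻¹ := by rwa [← one_div, lt_div_iff₀ hβ]
      linarith)
    convert this using 1
    rw [smul_sub, smul_smul, inv_mul_cancel₀ hβ.ne']
    module
  -- In the basis u, w the points are x ~ u + αw and y ~ u + β⁻¹w, so the cross ratio is 1/(αβ).
  refine ⟨_, hfr hu0 hα' hαC, _, hfr hw0 hβ' hβC, β⁻¹ / α, ?_, ?_, ?_⟩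
  · rw [le_div_iff₀ hα, one_mul, ← one_div, le_div_iff₀ hβ]
    exact hαβ.le
  · exact ⟨_, _, α, β⁻¹, hli, hα.ne', ⟨hu0, rfl⟩, ⟨hw0, rfl⟩, hrx, hry, rfl⟩
  · exact ⟨_, _, α, α, hli, hα.ne', ⟨hu0, rfl⟩, ⟨hw0, rfl⟩, hrx, hrx, (div_self hα.ne').symm⟩

/-- Needed to extract a cross ratio from an upper bound on the infimum, since the real infimum of
the empty set is 0 by convention. -/
lemma hilbertDist_set_nonempty (hne : Ω.Nonempty) (hd : 1 ≤ d) {x y : Fin (d + 1) → ℝ}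
    (hx : x ∈ coneOver Ω η) (hy : y ∈ coneOver Ω η) (hx0 : x ≠ 0) (hy0 : y ≠ 0) :
    {r : ℝ | ∃ z₁ ∈ frontier Ω, ∃ z₂ ∈ frontier Ω, ∃ c : ℝ, 1 ≤ c ∧
      HasCrossRatio z₁ (Projectivization.mk ℝ x hx0) (Projectivization.mk ℝ y hy0) z₂ c ∧
      r = 1 / 2 * Real.log c}.Nonempty := by
  have hC := hη.isSharpCone hne
  by_cases hxy : LinearIndependent ℝ ![x, y]
  · obtain ⟨z₁, h₁, z₂, h₂, c, hc, h, -⟩ := hη.exists_hasCrossRatio hne hx hy hxy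
      (hx0 := hx0) (hy0 := hy0)
    exact ⟨_, z₁, h₁, z₂, h₂, c, hc, h, rfl⟩
  -- Here the two projective points coincide, and any line through x gives the cross ratio 1.
  · obtain ⟨w, hw⟩ : ∃ w, LinearIndependent ℝ ![x, w] := by
      by_contra! hall
      have htop : Submodule.span ℝ {x} = ⊤ := by
        rw [Submodule.eq_top_iff']
        intro w
        have := hall w
        rw [LinearIndependent.pair_iff' hx0] at this
        push Not at this
        exact Submodule.mem_span_singleton.2 this
      have h1 := finrank_span_singleton (K := ℝ) hx0
      rw [htop, finrank_top, Module.finrank_fin_fun] at h1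
      omega
    obtain ⟨ε, hε, hmem⟩ := hC.exists_sub_smul_mem hx w
    have hz := hmem ε (by rw [abs_of_pos hε])
    have hxz : LinearIndependent ℝ ![x, x - ε • w] := by
      rw [LinearIndependent.pair_iff] at hw ⊢
      intro s t hst
      obtain ⟨h1, h2⟩ := hw (s + t) (-(t * ε)) (by rw [← hst]; module)
      have ht : t = 0 := by
        have : t * ε = 0 := by linarith
        exact (mul_eq_zero.1 this).resolve_right hε.ne'
      exact ⟨by rw [ht] at h1; linarith, ht⟩
    obtain ⟨z₁, h₁, z₂, h₂, -, -, -, h⟩ := hη.exists_hasCrossRatio hne hx hz hxz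
      (hx0 := hx0) (hy0 := hC.ne_zero hz)
    have heq : Projectivization.mk ℝ x hx0 = Projectivization.mk ℝ y hy0 := by
      rw [LinearIndependent.pair_iff' hx0] at hxy
      push Not at hxy
      obtain ⟨a, ha⟩ := hxy
      exact ((Projectivization.mk_eq_mk_iff' ℝ _ _ _ _).2 ⟨a, ha⟩).symm
    rw [← heq]
    exact ⟨_, z₁, h₁, z₂, h₂, 1, le_rfl, h, rfl⟩

/-- Points at small Hilbert distance have comparable lifts. -/
lemma exists_le_of_hilbertDist_lt (hne : Ω.Nonempty) (hd : 1 ≤ d) {x y : Fin (d + 1) → ℝ}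
    (hx : x ∈ coneOver Ω η) (hy : y ∈ coneOver Ω η) {hx0 : x ≠ 0} {hy0 : y ≠ 0} {ε : ℝ}
    (hε : 0 < ε) (h : hilbertDist Ω (Projectivization.mk ℝ x hx0) (Projectivization.mk ℝ y hy0) <
      1 / 2 * Real.log (1 + ε)) :
    ∃ r : ℝ, 0 < r ∧ r • y - x ∈ closure (coneOver Ω η) ∧
      (1 + ε) • x - r • y ∈ closure (coneOver Ω η) := by
  have hC := hη.isSharpCone hne
  obtain ⟨_, ⟨z₁, h₁, z₂, h₂, c, hc, ⟨u, w, s, t, -, hs, hu, hw, hxr, hyr, rfl⟩, rfl⟩, hlt⟩ :=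
    exists_lt_of_csInf_lt (hη.hilbertDist_set_nonempty hne hd hx hy hx0 hy0) h
  have hcε : t / s < 1 + ε := by
    have : Real.log (t / s) < Real.log (1 + ε) := by linarith
    exact (Real.log_lt_log_iff (by linarith) (by linarith)).1 this
  obtain ⟨l, hl, hxl⟩ := hxr.exists_smul_eq
  obtain ⟨m, hm, hym⟩ := hyr.exists_smul_eq
  obtain ⟨hu0, rfl⟩ := hu
  obtain ⟨hw0, rfl⟩ := hw
  rw [hη.mk_mem_frontier_iff hne] at h₁ h₂
  -- The boundary vectors may lie over the opposite component. Signs σ, τ bring them to the closure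
  -- of `C`, and the parameters s, t are multiplied by στ.
  have hsign : ∀ v : Fin (d + 1) → ℝ,
      ((v ∈ closure (coneOver Ω η) ∨ -v ∈ closure (coneOver Ω η)) ∧
        v ∉ coneOver Ω η ∧ -v ∉ coneOver Ω η) → ∃ σ : ℝ, σ * σ = 1 ∧
        σ • v ∈ closure (coneOver Ω η) ∧ σ • v ∉ coneOver Ω η := by
    rintro v ⟨h | h, h1, h2⟩
    · exact ⟨1, by norm_num, by simpa using h, by simpa using h1⟩
    · exact ⟨-1, by norm_num, by simpa using h, by simpa using h2⟩
  obtain ⟨σ, hσ, huc, huC⟩ := hsign u h₁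
  obtain ⟨τ, hτ, hwc, hwC⟩ := hsign w h₂
  have hσ0 : σ ≠ 0 := fun h => by simp [h] at hσ
  have hτ0 : τ ≠ 0 := fun h => by simp [h] at hτ
  have hτ' : ∀ a : ℝ, (σ * τ * a) • τ • w = σ • a • w := fun a => by
    rw [smul_smul, smul_smul]
    congr 1
    linear_combination (σ * a) * hτ
  have hdiv : σ * τ * t / (σ * τ * s) = t / s := by
    field_simp
  obtain ⟨r, hr, hr1, hr2⟩ := hC.le_of_crossRatio hx hy huc huC hwc hwC (s := σ * τ * s)
    (t := σ * τ * t) (l := σ * l) (m := σ * m) (by positivity) (by positivity) (by positivity)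
    (by rw [hτ', ← smul_add, hxl, smul_smul]) (by rw [hτ', ← smul_add, hym, smul_smul])
    (by rwa [hdiv])
  rw [hdiv] at hr2
  refine ⟨r, hr, hr1, ?_⟩
  have h3 : (1 + ε) • x - r • y = (1 + ε - t / s) • x + ((t / s) • x - r • y) := by module
  rw [h3]
  exact hC.closure_add (subset_closure (hC.smul_mem (by linarith) hx)) hr2

end IsConvexChart

end HilbertDistance

/-! ### Open simplices and their boundaries -/

section Simplices

variable {d k : ℕ}

lemma Represents.neg {v : Fin (d + 1) → ℝ} {p : RP d} (h : Represents v p) :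
    Represents (-v) p := by
  obtain ⟨hv, rfl⟩ := h
  simpa using represents_smul hv (c := -1) (by norm_num)

lemma openSimplex_neg (e : Fin k → Fin (d + 1) → ℝ) :
    openSimplex (fun i => -e i) = openSimplex e := by
  have h : ∀ a : Fin k → ℝ, ∑ i, a i • -e i = -∑ i, a i • e i := fun a => by simp
  ext p
  constructor
  · rintro ⟨a, ha, hp⟩
    refine ⟨a, ha, ?_⟩
    simpa [h] using hp.neg
  · rintro ⟨a, ha, hp⟩
    refine ⟨a, ha, ?_⟩
    rw [h]
    exact hp.neg

lemma mk_mem_openSimplex {e : Fin k → Fin (d + 1) → ℝ} {a : Fin k → ℝ} (ha : ∀ i, 0 < a i)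
    (h : ∑ i, a i • e i ≠ 0) : Projectivization.mk ℝ _ h ∈ openSimplex e :=
  ⟨a, ha, h, rfl⟩

section LinearIndependent

variable {e : Fin k → Fin (d + 1) → ℝ} (he : LinearIndependent ℝ e)
include he

lemma sum_smul_ne_zero {b : Fin k → ℝ} {i : Fin k} (hi : b i ≠ 0) : ∑ i, b i • e i ≠ 0 :=
  fun h => hi (Fintype.linearIndependent_iff.1 he b h i)

lemma mk_notMem_openSimplex {b : Fin k → ℝ} {j : Fin k} (hj : b j = 0)
    (h : ∑ i, b i • e i ≠ 0) : Projectivization.mk ℝ _ h ∉ openSimplex e := by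
  rintro ⟨a, ha, hrep⟩
  obtain ⟨c, -, hc⟩ := hrep.exists_smul_eq
  have h1 : ∑ i, (a i - c * b i) • e i = 0 := by
    simp only [sub_smul, mul_smul, Finset.sum_sub_distrib, ← Finset.smul_sum]
    rw [hc, sub_self]
  have h2 := Fintype.linearIndependent_iff.1 he _ h1 j
  rw [hj, mul_zero, sub_zero] at h2
  exact (ha j).ne' h2

lemma mk_mem_closure_openSimplex {b : Fin k → ℝ} (hb : ∀ i, 0 ≤ b i)
    (h : ∑ i, b i • e i ≠ 0) : Projectivization.mk ℝ _ h ∈ closure (openSimplex e) := by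
  rw [← mem_preimage_iff h]
  refine mem_preimage_closure h ?_
  have hlim : Tendsto (fun n : ℕ => ∑ i, (b i + 1 / ((n : ℝ) + 1)) • e i) atTop
      (𝓝 (∑ i, (b i + 0) • e i)) :=
    tendsto_finsetSum _ fun i _ =>
      (tendsto_one_div_add_atTop_nhds_zero_nat.const_add (b i)).smul_const (e i)
  simp only [add_zero] at hlim
  refine mem_closure_of_tendsto hlim (Eventually.of_forall fun n => ?_)
  have hpos : ∀ i, 0 < b i + 1 / ((n : ℝ) + 1) := fun i =>
    add_pos_of_nonneg_of_pos (hb i) (by positivity)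
  obtain ⟨i, -, -⟩ := Finset.exists_ne_zero_of_sum_ne_zero h
  have hne := sum_smul_ne_zero he (b := fun i => b i + 1 / ((n : ℝ) + 1)) (hpos i).ne'
  exact (mem_preimage_iff hne).2 (mk_mem_openSimplex hpos hne)

lemma mk_mem_relBoundary {b : Fin k → ℝ} (hb : ∀ i, 0 ≤ b i) {j : Fin k} (hj : b j = 0)
    (h : ∑ i, b i • e i ≠ 0) : Projectivization.mk ℝ _ h ∈ relBoundary (openSimplex e) :=
  ⟨mk_mem_closure_openSimplex he hb h, mk_notMem_openSimplex he hj h⟩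

lemma mk_vertex_mem_relBoundary {i j : Fin k} (hij : i ≠ j) (h : e i ≠ 0) :
    Projectivization.mk ℝ _ h ∈ relBoundary (openSimplex e) := by
  have hsum : ∑ l, (Pi.single i (1 : ℝ) : Fin k → ℝ) l • e l = e i := by
    rw [Finset.sum_eq_single i (fun l _ hl => by rw [Pi.single_eq_of_ne hl, zero_smul]) (by simp)]
    rw [Pi.single_eq_same, one_smul]
  have := mk_mem_relBoundary he (b := Pi.single i 1) (fun l => ?_) (j := j)
    (Pi.single_eq_of_ne hij.symm _) (by rwa [hsum])
  · simpa only [hsum] using this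
  · by_cases hl : l = i
    · rw [hl, Pi.single_eq_same]; exact zero_le_one
    · rw [Pi.single_eq_of_ne hl]

/-- An injective linear map is a closed embedding, so the nonnegative combinations form a closed
cone, whose projective image contains the closure of the simplex. -/
lemma exists_of_mem_relBoundary {p : RP d} (hp : p ∈ relBoundary (openSimplex e)) :
    ∃ b : Fin k → ℝ, (∀ i, 0 ≤ b i) ∧ (∃ j, b j = 0) ∧ Represents (∑ i, b i • e i) p := by
  have hinj : Function.Injective (Fintype.linearCombination ℝ e) := by
    rw [injective_iff_map_eq_zero]
    intro c hc
    ext i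
    exact Fintype.linearIndependent_iff.1 he c (by simpa [Fintype.linearCombination_apply] using hc) i
  have hQ : IsClosed (Fintype.linearCombination ℝ e '' {b | ∀ i, 0 ≤ b i}) := by
    refine (LinearMap.isClosedEmbedding_of_injective (LinearMap.ker_eq_bot.2 hinj)).isClosedMap _ ?_
    rw [Set.ofPred_forall]
    exact isClosed_iInter fun i => isClosed_le continuous_const (continuous_apply i)
  have hcl := isClosed_setOf_represents (d := d) hQ (by
    rintro c hc _ ⟨b, hb, rfl⟩
    exact ⟨c • b, fun i => mul_nonneg hc.le (hb i), map_smul _ _ _⟩)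
  obtain ⟨_, ⟨b, hb, rfl⟩, hrep⟩ := closure_minimal (fun q hq => by
    obtain ⟨a, ha, hrep⟩ := hq
    exact ⟨_, ⟨a, fun i => (ha i).le, rfl⟩, by
      simpa [Fintype.linearCombination_apply] using hrep⟩) hcl hp.1
  rw [Fintype.linearCombination_apply] at hrep
  refine ⟨b, hb, ?_, hrep⟩
  by_contra! hne
  exact hp.2 ⟨b, fun i => (hb i).lt_of_ne (hne i).symm, hrep⟩

end LinearIndependent

end Simplices

/-! ### Hyperplanes and faces of simplices -/

section Hyperplanes

variable {d : ℕ}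

lemma IsHyperplane.exists_functional
    {H : Projectivization.Subspace ℝ (Fin (d + 1) → ℝ)} (hH : IsHyperplane H) :
    ∃ h : (Fin (d + 1) → ℝ) →L[ℝ] ℝ, h ≠ 0 ∧
      ∀ (v : Fin (d + 1) → ℝ) (hv : v ≠ 0), Projectivization.mk ℝ v hv ∈ H ↔ h v = 0 := by
  have hH' : Module.finrank ℝ (Projectivization.Subspace.submodule H) = d := hH
  have hlt : Projectivization.Subspace.submodule H < ⊤ := by
    apply Submodule.lt_top_of_finrank_lt_finrank
    rw [hH', Module.finrank_fin_fun]
    exact Nat.lt_succ_self d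
  obtain ⟨f, hf, hle⟩ := Submodule.exists_le_ker_of_lt_top _ hlt
  have heq : Projectivization.Subspace.submodule H = LinearMap.ker f := by
    apply Submodule.eq_of_le_of_finrank_eq hle
    have h1 := Module.Dual.finrank_ker_add_one_of_ne_zero hf
    rw [Module.finrank_fin_fun] at h1
    rw [hH']
    exact (Nat.succ_injective h1).symm
  refine ⟨LinearMap.toContinuousLinearMap f, fun h => hf (by simpa using h), fun v hv => ?_⟩
  rw [← Projectivization.Subspace.mem_submodule_iff _ hv, heq]
  rfl

/-- The projective hyperplane defined by a functional. -/
noncomputable def hyperplaneOf (h : (Fin (d + 1) → ℝ) →L[ℝ] ℝ) :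
    Projectivization.Subspace ℝ (Fin (d + 1) → ℝ) :=
  Submodule.projectivization (LinearMap.ker h.toLinearMap)

lemma mk_mem_hyperplaneOf {h : (Fin (d + 1) → ℝ) →L[ℝ] ℝ} {v : Fin (d + 1) → ℝ} (hv : v ≠ 0) :
    Projectivization.mk ℝ v hv ∈ hyperplaneOf h ↔ h v = 0 :=
  Submodule.mk_mem_projectivization_iff _ hv

lemma isHyperplane_hyperplaneOf {h : (Fin (d + 1) → ℝ) →L[ℝ] ℝ} (h0 : h ≠ 0) :
    IsHyperplane (hyperplaneOf h) := by
  have h1 := Module.Dual.finrank_ker_add_one_of_ne_zero (f := h.toLinearMap) (by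
    intro h2
    exact h0 (ContinuousLinearMap.coe_injective h2))
  rw [Module.finrank_fin_fun] at h1
  unfold IsHyperplane hyperplaneOf
  rw [OrderIso.apply_symm_apply]
  exact Nat.succ_injective h1

/-- A linear form without zeros on the open positive orthant has coefficients of a constant sign. -/
lemma nonneg_or_nonpos_of_forall_pos {ι : Type*} [Fintype ι] [DecidableEq ι] {c : ι → ℝ}
    (h : ∀ a : ι → ℝ, (∀ i, 0 < a i) → ∑ i, a i * c i ≠ 0) :
    (∀ i, 0 ≤ c i) ∨ ∀ i, c i ≤ 0 := by
  by_contra! hcon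
  obtain ⟨⟨n, hn⟩, ⟨p, hp⟩⟩ := hcon
  -- Starting from all weights 1, raising the weight of a coefficient of the appropriate sign
  -- produces a forbidden zero.
  have main : ∀ q, c q ≠ 0 → 0 ≤ -(∑ i, c i) / c q → False := by
    intro q hq h0
    refine h (fun i => 1 + if i = q then -(∑ i, c i) / c q else 0) (fun i => ?_) ?_
    · split_ifs <;> linarith
    · simp only [add_mul, one_mul, Finset.sum_add_distrib, ite_mul, zero_mul, Finset.sum_ite_eq',
        Finset.mem_univ, if_true]
      rw [div_mul_cancel₀ _ hq]
      ring
  rcases le_total (∑ i, c i) 0 with h0 | h0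
  · exact main p hp.ne' (div_nonneg (by linarith) hp.le)
  · exact main n hn.ne (div_nonneg_of_nonpos (by linarith) hn.le)

/-- A codimension-one face of a simplex contains all the vertices but one. -/
lemma IsFace.exists_vertices_mem {e : Fin d → Fin (d + 1) → ℝ} (he : LinearIndependent ℝ e)
    (hd : 2 ≤ d) {K : Set (RP d)} (hK : IsFace (openSimplex e) (d - 2) K) :
    ∃ j, ∀ i, i ≠ j → ∀ h : e i ≠ 0, Projectivization.mk ℝ _ h ∈ K := by
  obtain ⟨⟨P, hP, hdisj, rfl⟩, hrank⟩ := hK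
  obtain ⟨l, -, hl⟩ := hP.exists_functional
  have hsign := nonneg_or_nonpos_of_forall_pos (c := fun i => l (e i)) (fun a ha h0 => by
    have hne := sum_smul_ne_zero he (ha ⟨0, by omega⟩).ne'
    refine Set.disjoint_left.1 hdisj ((hl _ hne).2 ?_) (mk_mem_openSimplex ha hne)
    simpa using h0)
  have hzero : ∀ b : Fin d → ℝ, (∀ i, 0 ≤ b i) → ∑ i, b i * l (e i) = 0 →
      ∀ i, b i * l (e i) = 0 := by
    intro b hb h0 i
    rcases hsign with h | h
    · exact (Finset.sum_eq_zero_iff_of_nonneg fun i _ => mul_nonneg (hb i) (h i)).1 h0 i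
        (Finset.mem_univ i)
    · exact (Finset.sum_eq_zero_iff_of_nonpos fun i _ =>
        mul_nonpos_of_nonneg_of_nonpos (hb i) (h i)).1 h0 i (Finset.mem_univ i)
  -- By the constant sign of `l`, the face is spanned by vertices in ker l. Two vertices outside it
  -- would leave rank at most d - 2, but a (d - 2)-dimensional face has rank d - 1.
  obtain ⟨j, hj⟩ : ∃ j, ∀ i, i ≠ j → l (e i) = 0 := by
    by_contra! hcon
    obtain ⟨j, -, hj⟩ := hcon ⟨0, by omega⟩
    obtain ⟨k, hkj, hk⟩ := hcon j
    set s : Finset (Fin (d + 1) → ℝ) := ((Finset.univ.erase j).erase k).image e with hs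
    have hle : Projectivization.Subspace.submodule
        (Projectivization.Subspace.span (relBoundary (openSimplex e) ∩ P)) ≤
        Submodule.span ℝ (s : Set (Fin (d + 1) → ℝ)) := by
      rw [← OrderIso.le_symm_apply, Projectivization.Subspace.span_le_subspace_iff]
      rintro p ⟨hp, hpP⟩
      obtain ⟨b, hb, -, hb0, rfl⟩ := exists_of_mem_relBoundary he hp
      have h0 := (hl _ hb0).1 hpP
      simp only [map_sum, map_smul, smul_eq_mul] at h0
      have hz := hzero b hb h0
      refine (Submodule.mk_mem_projectivization_iff _ hb0).2 (Submodule.sum_mem _ fun i _ => ?_)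
      by_cases hi : i = j ∨ i = k
      · have hbi : b i = 0 := by
          rcases hi with rfl | rfl
          · exact (mul_eq_zero.1 (hz i)).resolve_right hj
          · exact (mul_eq_zero.1 (hz i)).resolve_right hk
        rw [hbi, zero_smul]
        exact Submodule.zero_mem _
      · push Not at hi
        refine Submodule.smul_mem _ _ (Submodule.subset_span ?_)
        rw [hs, Finset.mem_coe]
        exact Finset.mem_image_of_mem _ (by simp [hi.1, hi.2])
    have h1 := Submodule.finrank_mono hle
    have h2 := finrank_span_finset_le_card (R := ℝ) s
    have h3 : s.card ≤ d - 1 - 1 := by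
      refine Finset.card_image_le.trans_eq ?_
      rw [Finset.card_erase_of_mem (by simp [hkj]), Finset.card_erase_of_mem (Finset.mem_univ j),
        Finset.card_univ, Fintype.card_fin]
    have h4 : Module.finrank ℝ (Submodule.span ℝ (s : Set (Fin (d + 1) → ℝ))) ≤ s.card := h2
    rw [hrank] at h1
    omega
  exact ⟨j, fun i hij h => ⟨mk_vertex_mem_relBoundary he hij h, (hl _ h).2 (hj i hij)⟩⟩

/-- A functional which vanishes on all the vertices of a simplex but one cuts out a face. -/
lemma isFace_of_functional {e : Fin d → Fin (d + 1) → ℝ} (he : LinearIndependent ℝ e)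
    (hd : 2 ≤ d) {h : (Fin (d + 1) → ℝ) →L[ℝ] ℝ} {j : Fin d} (hz : ∀ i, i ≠ j → h (e i) = 0)
    (hj : h (e j) ≠ 0) : IsFace (openSimplex e) (d - 2)
      (relBoundary (openSimplex e) ∩ hyperplaneOf h) := by
  have h0 : h ≠ 0 := by
    rintro rfl
    exact hj rfl
  have hmem : ∀ {b : Fin d → ℝ} (hb : ∑ i, b i • e i ≠ 0),
      Projectivization.mk ℝ _ hb ∈ hyperplaneOf h ↔ b j = 0 := by
    intro b hb
    rw [mk_mem_hyperplaneOf, IsConeFlat.apply_sum hz, mul_eq_zero, or_iff_left hj]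
  refine ⟨⟨hyperplaneOf h, isHyperplane_hyperplaneOf h0, ?_, rfl⟩, ?_⟩
  · rw [Set.disjoint_right]
    rintro _ ⟨a, ha, hne, rfl⟩ hmem'
    exact (ha j).ne' ((hmem hne).1 hmem')
  · have heq : Projectivization.Subspace.submodule (Projectivization.Subspace.span
        (relBoundary (openSimplex e) ∩ hyperplaneOf h)) =
        Submodule.span ℝ (Set.range (e ∘ (Subtype.val : {i // i ≠ j} → Fin d))) := by
      apply le_antisymm
      · rw [← OrderIso.le_symm_apply, Projectivization.Subspace.span_le_subspace_iff]
        rintro p ⟨hp, hpH⟩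
        obtain ⟨b, hb, -, hb0, rfl⟩ := exists_of_mem_relBoundary he hp
        have hbj := (hmem hb0).1 hpH
        refine (Submodule.mk_mem_projectivization_iff _ hb0).2 (Submodule.sum_mem _ fun i _ => ?_)
        by_cases hij : i = j
        · rw [hij, hbj, zero_smul]
          exact Submodule.zero_mem _
        · exact Submodule.smul_mem _ _ (Submodule.subset_span ⟨⟨i, hij⟩, rfl⟩)
      · rw [Submodule.span_le]
        rintro _ ⟨⟨i, hij⟩, rfl⟩
        have hi0 := he.ne_zero i
        refine (Projectivization.Subspace.mem_submodule_iff _ hi0).2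
          (Projectivization.Subspace.subset_span _ ⟨mk_vertex_mem_relBoundary he hij hi0, ?_⟩)
        exact (mk_mem_hyperplaneOf hi0).2 (hz i hij)
    rw [heq, finrank_span_eq_card (he.comp _ Subtype.val_injective), Fintype.card_subtype_compl,
      Fintype.card_fin, Fintype.card_subtype_eq]
    omega

end Hyperplanes

/-! ### Flats, supporting hyperplanes and pseudo-duals of a domain -/

namespace IsConvexChart

variable {d : ℕ} {Ω : Set (RP d)} {η : Module.Dual ℝ (Fin (d + 1) → ℝ)}
  (hη : IsConvexChart Ω η)
include hη

lemma exists_isConeFlat (hne : Ω.Nonempty) (hd : 1 ≤ d) {F : Set (RP d)} (hF : F ∈ flats Ω) :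
    ∃ e : Fin d → Fin (d + 1) → ℝ, IsConeFlat (coneOver Ω η) e ∧ F = openSimplex e := by
  obtain ⟨⟨e₀, he₀, hFe₀⟩, hFΩ, hbd⟩ := hF
  have hpre : ∀ {e : Fin d → Fin (d + 1) → ℝ}, LinearIndependent ℝ e → F = openSimplex e →
      ∀ a : Fin d → ℝ, (∀ i, 0 < a i) → ∑ i, a i • e i ∈ preimage Ω := by
    intro e he hFe a ha
    have hne := sum_smul_ne_zero he (ha ⟨0, hd⟩).ne'
    exact (mem_preimage_iff hne).2 (hFΩ (hFe ▸ mk_mem_openSimplex ha hne))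
  obtain ⟨e, he, hFe, hsum⟩ : ∃ e : Fin d → Fin (d + 1) → ℝ, LinearIndependent ℝ e ∧
      F = openSimplex e ∧ ∑ i, e i ∈ coneOver Ω η := by
    have h1 := hpre he₀ hFe₀ 1 (by simp)
    simp only [Pi.one_apply, one_smul] at h1
    -- The representatives are determined up to a common sign, chosen so that their sum lies over
    -- the positive component.
    rcases hη.mem_or_neg_mem h1 with h | h
    · exact ⟨e₀, he₀, hFe₀, h⟩
    · refine ⟨fun i => -e₀ i, ?_, by rw [openSimplex_neg, hFe₀], by simpa using h⟩
      rw [Fintype.linearIndependent_iff] at he₀ ⊢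
      exact fun c hc => he₀ c (by simpa using hc)
  have hpos : ∀ a : Fin d → ℝ, (∀ i, 0 < a i) → ∑ i, a i • e i ∈ coneOver Ω η := by
    intro a ha
    rcases hη.mem_or_neg_mem (hpre he hFe a ha) with h | h
    · exact h
    exfalso
    have h1 : 0 < η (∑ i, e i) := hsum.1
    have h2 : 0 < -η (∑ i, a i • e i) := by simpa only [map_neg] using h.1
    have h3 := hpre he hFe (fun i => η (∑ i, e i) * a i + -η (∑ i, a i • e i)) fun i =>
      add_pos (mul_pos h1 (ha i)) h2
    refine hη.ne_zero_of_mem h3 ?_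
    simp only [add_smul, mul_smul, Finset.sum_add_distrib, ← Finset.smul_sum, map_add, map_smul,
      smul_eq_mul]
    ring
  refine ⟨e, ⟨fun j => ?_, hsum, fun b hb j hj hmem => ?_⟩, hFe⟩
  · have hlim : Tendsto (fun n : ℕ => ∑ i, ((Pi.single j (1 : ℝ) : Fin d → ℝ) i +
        1 / ((n : ℝ) + 1)) • e i) atTop
        (𝓝 (∑ i, ((Pi.single j (1 : ℝ) : Fin d → ℝ) i + 0) • e i)) :=
      tendsto_finsetSum _ fun i _ =>
        (tendsto_one_div_add_atTop_nhds_zero_nat.const_add _).smul_const (e i)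
    have hsingle : ∑ i, ((Pi.single j (1 : ℝ) : Fin d → ℝ) i + 0) • e i = e j := by
      rw [Finset.sum_eq_single j (fun l _ hl => by
        rw [Pi.single_eq_of_ne hl, add_zero, zero_smul]) (by simp)]
      rw [Pi.single_eq_same, add_zero, one_smul]
    rw [hsingle] at hlim
    refine mem_closure_of_tendsto hlim (Eventually.of_forall fun n => hpos _ fun i => ?_)
    refine add_pos_of_nonneg_of_pos ?_ (by positivity)
    by_cases hi : i = j
    · rw [hi, Pi.single_eq_same]; exact zero_le_one
    · rw [Pi.single_eq_of_ne hi]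
  · have h0 := (hη.isSharpCone hne).ne_zero hmem
    have := hbd (hFe ▸ mk_mem_relBoundary he hb hj h0)
    rw [hη.mk_mem_frontier_iff hne] at this
    exact this.2.1 hmem

lemma exists_functional_of_supports (hne : Ω.Nonempty)
    {H : Projectivization.Subspace ℝ (Fin (d + 1) → ℝ)} {K : Set (RP d)} (hH : Supports Ω H K) :
    ∃ h : (Fin (d + 1) → ℝ) →L[ℝ] ℝ, h ≠ 0 ∧ (∀ x ∈ coneOver Ω η, 0 ≤ h x) ∧
      ∀ (v : Fin (d + 1) → ℝ) (hv : v ≠ 0), Projectivization.mk ℝ v hv ∈ H ↔ h v = 0 := by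
  have hC := hη.isSharpCone hne
  obtain ⟨h, h0, hmem⟩ := hH.1.exists_functional
  have hnz : ∀ x ∈ coneOver Ω η, h x ≠ 0 := fun x hx hx0 =>
    Set.disjoint_left.1 hH.2.2 ((hmem x (hC.ne_zero hx)).2 hx0)
      ((mem_preimage_iff (hC.ne_zero hx)).1 hx.2)
  by_cases hnn : ∀ x ∈ coneOver Ω η, 0 ≤ h x
  · exact ⟨h, h0, hnn, hmem⟩
  push Not at hnn
  obtain ⟨x, hx, hxneg⟩ := hnn
  refine ⟨-h, neg_ne_zero.2 h0, fun y hy => ?_, fun v hv => by simp [hmem v hv]⟩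
  by_contra! hy0
  have hypos : 0 < h y := by simpa using hy0
  -- Opposite signs of h at x and y would give a zero of h at a positive combination, inside the
  -- cone.
  refine hnz _ (hC.add_mem (hC.smul_mem hypos hx) (hC.smul_mem (neg_pos.2 hxneg) hy)) ?_
  simp only [map_add, map_smul, smul_eq_mul]
  ring

lemma supports_hyperplaneOf {h : (Fin (d + 1) → ℝ) →L[ℝ] ℝ} (h0 : h ≠ 0)
    (hpos : ∀ x ∈ coneOver Ω η, 0 < h x) {K : Set (RP d)} (hK : K ⊆ hyperplaneOf h) :
    Supports Ω (hyperplaneOf h) K := by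
  refine ⟨isHyperplane_hyperplaneOf h0, hK, ?_⟩
  rw [Set.disjoint_left]
  intro p
  induction p using Projectivization.ind with | h v hv => ?_
  intro hp hpΩ
  rw [SetLike.mem_coe, mk_mem_hyperplaneOf] at hp
  rcases hη.mem_or_neg_mem ((mem_preimage_iff hv).2 hpΩ) with h1 | h1
  · exact (hpos _ h1).ne' hp
  · have := hpos _ h1
    rw [map_neg, hp, neg_zero] at this
    exact lt_irrefl _ this

/-- The common zero of the supporting functionals along the facets is the pseudo-dual. -/
lemma exists_isPseudoDual (hne : Ω.Nonempty) (hcc : IsCocompactCone (coneOver Ω η))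
    (hsplit : ¬ Splits (coneOver Ω η)) (hd : 2 ≤ d) {e : Fin d → Fin (d + 1) → ℝ}
    (he : IsConeFlat (coneOver Ω η) e) : ∃ p, IsPseudoDual Ω (openSimplex e) p := by
  have hC := hη.isSharpCone hne
  have hfin : Module.finrank ℝ (Fin (d + 1) → ℝ) = d + 1 := Module.finrank_fin_fun ℝ
  choose h hpos hz hdiag using fun j => he.exists_support hC j
  have h0 : ∀ j, h j ≠ 0 := fun j h0 => by
    have := hdiag j
    rw [h0] at this
    exact lt_irrefl _ this
  obtain ⟨v, hv0, hv⟩ := IsConeFlat.exists_ne_zero_of_functionals hfin h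
  refine ⟨Projectivization.mk ℝ v hv0, fun q => ⟨fun hq => ?_, ?_⟩⟩
  · induction q using Projectivization.ind with | h w hw0 => ?_
    have hw : ∀ j, h j w = 0 := fun j =>
      (mk_mem_hyperplaneOf hw0).1 (hq _ (isFace_of_functional he.linearIndependent hd (hz j)
        (hdiag j).ne') _ (hη.supports_hyperplaneOf (h0 j) (hpos j) Set.inter_subset_right))
    obtain ⟨c, hc⟩ := IsConeFlat.exists_eq_smul hfin he.linearIndependent hz hdiag hv hw hv0
    exact (Projectivization.mk_eq_mk_iff' ℝ _ _ _ _).2 ⟨c, hc.symm⟩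
  · rintro rfl K hK H hH
    obtain ⟨j, hj⟩ := hK.exists_vertices_mem he.linearIndependent hd
    obtain ⟨g, hg0, hgnn, hgH⟩ := hη.exists_functional_of_supports hne hH
    have hgz : ∀ i, i ≠ j → g (e i) = 0 := fun i hij =>
      (hgH _ (he.linearIndependent.ne_zero i)).1 (hH.2.1 (hj i hij _))
    -- The chosen `h j` thus account for every supporting hyperplane along the facet opposite to `e
    -- j`.
    obtain ⟨c, rfl⟩ := he.support_unique hC hcc hsplit hfin hd (fun x hx => (hpos j x hx).le)
      (h0 j) hgnn (hz j) hgz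
    exact (hgH v hv0).2 (by simp [hv j])

/-- A pseudo-dual is a common zero of supporting functionals along the facets. -/
lemma exists_isSupportFamily (hne : Ω.Nonempty) (hd : 2 ≤ d) {e : Fin d → Fin (d + 1) → ℝ}
    (he : IsConeFlat (coneOver Ω η) e) {v : Fin (d + 1) → ℝ} {hv : v ≠ 0}
    (hp : IsPseudoDual Ω (openSimplex e) (Projectivization.mk ℝ v hv)) :
    ∃ h, IsSupportFamily (coneOver Ω η) e h ∧ ∀ j, h j v = 0 := by
  have hC := hη.isSharpCone hne
  choose h hpos hz hdiag using fun j => he.exists_support hC j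
  have h0 : ∀ j, h j ≠ 0 := fun j h0 => by
    have := hdiag j
    rw [h0] at this
    exact lt_irrefl _ this
  refine ⟨h, fun j => ⟨fun x hx => (hpos j x hx).le, h0 j, hz j⟩, fun j => ?_⟩
  exact (mk_mem_hyperplaneOf hv).1 ((hp _).2 rfl _ (isFace_of_functional he.linearIndependent hd
    (hz j) (hdiag j).ne') _
    (hη.supports_hyperplaneOf (h0 j) (hpos j) Set.inter_subset_right))

end IsConvexChart

end HilbertGeometry

/-! ### The main theorem -/

open HilbertGeometry
theorem mainTheorem10 (d : ℕ) (hd : 3 ≤ d) (Ω : Set (RP d)) (hconv : IsProperlyConvex Ω)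
    (hdiv : IsDivisible Ω) (hirr : ¬ IsReducible Ω) :
    (∀ F ∈ flats Ω, ∃ p, IsPseudoDual Ω F p) ∧
    ∃ ε : ℝ, 0 < ε ∧ ∀ F ∈ flats Ω, ∀ F' ∈ flats Ω, ∀ x ∈ F, hilbertInfDist Ω x F' < ε →
      ∀ p, IsPseudoDual Ω F p → (projLine x p ∩ F').Nonempty := by
  obtain ⟨hopen, η, -, hη0, hηc⟩ := hconv
  have hη : IsConvexChart Ω η := ⟨hopen, hη0, hηc⟩
  -- Proper convexity as defined admits the empty set, which has no flats because open simplices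
  -- with independent vertices are nonempty.
  rcases Ω.eq_empty_or_nonempty with rfl | hne
  · have hempty : ∀ F ∈ flats (∅ : Set (RP d)), F = ∅ := fun F hF => Set.subset_empty_iff.1 hF.2.1
    have hflat : ∀ F, F ∉ flats (∅ : Set (RP d)) := by
      intro F hF
      obtain ⟨⟨e, he, hFe⟩, -, -⟩ := id hF
      have h1 : ∑ i, (1 : Fin d → ℝ) i • e i ≠ 0 :=
        sum_smul_ne_zero he (i := ⟨0, by omega⟩) one_ne_zero
      have h2 := mk_mem_openSimplex (by simp) h1
      rw [← hFe, hempty F hF] at h2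
      exact h2
    exact ⟨fun F hF => absurd hF (hflat F), 1, one_pos, fun F hF => absurd hF (hflat F)⟩
  have hC := hη.isSharpCone hne
  have hcc := hη.isCocompactCone hne hdiv
  have hsplit : ¬ Splits (coneOver Ω η) := fun h => hirr (hη.isReducible_of_splits hne h)
  refine ⟨fun F hF => ?_, ?_⟩
  · obtain ⟨e, he, rfl⟩ := hη.exists_isConeFlat hne (by omega) hF
    exact hη.exists_isPseudoDual hne hcc hsplit (by omega) he
  obtain ⟨ε, hε, hmain⟩ := exists_eps_meetsSimplex hC hcc hsplit (Module.finrank_fin_fun ℝ) hd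
  -- The Hilbert distance corresponding to a cross ratio of 1 + ε.
  refine ⟨1 / 2 * Real.log (1 + ε), mul_pos (by norm_num) (Real.log_pos (by linarith)), ?_⟩
  intro F hF F' hF' x hx hdist p hp
  obtain ⟨e, he, rfl⟩ := hη.exists_isConeFlat hne (by omega) hF
  obtain ⟨e', he', rfl⟩ := hη.exists_isConeFlat hne (by omega) hF'
  have hne' : (openSimplex e').Nonempty := by
    refine ⟨_, mk_mem_openSimplex (a := 1) (by simp) ?_⟩
    exact sum_smul_ne_zero he'.linearIndependent (i := ⟨0, by omega⟩) one_ne_zero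
  obtain ⟨_, ⟨y, hy, rfl⟩, hxy⟩ := exists_lt_of_csInf_lt (hne'.image _) hdist
  obtain ⟨a, ha, hx0, rfl⟩ := hx
  obtain ⟨b, hb, hy0, rfl⟩ := hy
  have hxC := he.sum_pos_mem hC ha
  obtain ⟨r, hr, hr1, hr2⟩ := hη.exists_le_of_hilbertDist_lt hne (by omega) hxC
    (he'.sum_pos_mem hC hb) hε hxy
  induction p using Projectivization.ind with | h v hv => ?_
  obtain ⟨h, hsupp, hhv⟩ := hη.exists_isSupportFamily hne (by omega) he hp
  have hsmul : ∑ i, (r * b i) • e' i = r • ∑ i, b i • e' i := by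
    rw [Finset.smul_sum]
    exact Finset.sum_congr rfl fun i _ => mul_smul _ _ _
  -- The factor r rescales the lift of y so that x ≤ ry ≤ (1 + ε)x.
  obtain ⟨τ, c, hc, hτ⟩ := hmain e e' a (fun i => r * b i) h v
    { flat := he
      flat' := he'
      nonneg := fun i => (ha i).le
      nonneg' := fun i => (mul_pos hr (hb i)).le
      mem := hxC
      le := by rwa [hsmul]
      ge := by rwa [hsmul]
      support := hsupp
      ne_zero := hv
      apply_eq_zero := hhv }
  have hne0 := hC.ne_zero (he'.sum_pos_mem hC hc)
  refine ⟨_, ?_, mk_mem_openSimplex hc hne0⟩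
  refine (Projectivization.Subspace.mem_submodule_iff _ hne0).1 ?_
  rw [← hτ]
  refine Submodule.add_mem _ ?_ (Submodule.smul_mem _ _ ?_)
  · exact (Projectivization.Subspace.mem_submodule_iff _ hx0).2
      (Projectivization.Subspace.subset_span _ (Or.inl rfl))
  · exact (Projectivization.Subspace.mem_submodule_iff _ hv).2
      (Projectivization.Subspace.subset_span _ (Or.inr rfl))
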